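/- A non-singular double cover is a finite surjective morphism $\phi:X\to Y$ of degree $2$ between non-singular varieties over $\mathbb C$ (integral, separated, of finite type and smooth over $\mathbb C$). Fix an invertible sheaf $\mathcal O_Y(-L)$ on $Y$, a section $F$ of $\mathcal O_Y(2L)$ and an isomorphism of $\mathcal O_Y$-algebras $\phi_*\mathcal O_X\cong\big(\bigoplus_{n\ge0}t^n\mathcal O_Y(-nL)\big)/(t^2-F)$; thus $\phi_*\mathcal O_X=\mathcal O_Y\oplus\mathcal O_Y(-L)\,t$. An admissible pair is a rank-$2$ vector bundle $\mathcal M$ on $Y$ with a morphism $M:\mathcal M(-L)\to\mathcal M$ such that $M^2=F\cdot\mathrm{id}_{\mathcal M}$. A line bundle $\mathcal L$ on $X$ is associated to $(\mathcal M,M)$ if there is an isomorphism $\phi_*\mathcal L\cong\mathcal M$ under which multiplication by $t$ corresponds to $M$. Let $\mathfrak U=\{U_i\}_{i\in I}$ be an affine open covering of $Y$ with trivializations of $\mathcal O_Y(-L)$ over each $U_i$. Let $\xi_{ij}\in\mathcal O_Y(U_i\cap U_j)^\times$ be the resulting transition functions of $\mathcal O_Y(-L)$, let $t_i$ be the image in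 $\phi_*\mathcal O_X$ of the generator over $U_i$ (so $t_j=t_i\xi_{ij}$), and put $F_i=t_i^2\in\mathcal O_Y(U_i)$. Given an admissible pair $(\mathcal M,M)$ and trivializations $\varphi_i:\mathcal M|_{U_i}\cong\mathcal O_{U_i}^{\oplus2}$, let $G_{ij}=\varphi_i\circ\varphi_j^{-1}\in\mathrm{GL}(2,\mathcal O_{U_i\cap U_j})$ be the transition functions, and let $M_i$ be the $2\times2$ matrix over $\mathcal O_Y(U_i)$ that represents $M$ over $U_i$. Then $(\{G_{ij}\},\{M_i\})_{\mathfrak U}$ is called a representation of $(\mathcal M,M)$; it is good if the lower left entry of $M_i$ is a unit on $U_i$ for every $i$. A line bundle on $X$ is associated to a representation if it is associated to an admissible pair that has this representation. **Theorem.** Let $(\mathcal M^{(k)},M^{(k)})$, $k=1,\dots,m$, be admissible pairs with good representations $(\{G^{(k)}_{ij}\},\{M^{(k)}_i\})_{\mathfrak U}$ over a common such covering, let $\mathcal L_k$ be a line bundle on $X$ associated to $(\mathcal M^{(k)},M^{(k)})$, and write $G^{(k)}_{ij}=(g^{(k)}_{ij,ab})_{a,b}$, $a^{(k)}_{i0}=(M^{(k)}_i)_{11}$,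 $a^{(k)}_{i1}=(M^{(k)}_i)_{21}$. Let $E$ be the identity matrix, put $M^{(0)}_i=\begin{pmatrix}0&F_i\\1&0\end{pmatrix}$, and define over $U_i\cap U_j$ $$K^{(k)+}_{ij}=\frac1{a^{(k)}_{i1}}\Big(\big(a^{(k)}_{i1}g^{(k)}_{ij,11}-a^{(k)}_{i0}g^{(k)}_{ij,21}\big)E+g^{(k)}_{ij,21}M^{(0)}_i\Big),$$ $$K^{(k)-}_{ij}=\frac{\xi_{ij}}{a^{(k)}_{i1}\det G^{(k)}_{ij}}\Big(\big(a^{(k)}_{i1}g^{(k)}_{ij,11}-a^{(k)}_{i0}g^{(k)}_{ij,21}\big)E-g^{(k)}_{ij,21}M^{(0)}_i\Big).$$ Then all $K^{(k)\pm}_{ij}$ lie in $\mathrm{GL}(2,\mathcal O_{U_i\cap U_j})$, and for all $n_1,\dots,n_m\in\mathbb Z$ the line bundle $\mathcal L_1^{\otimes n_1}\otimes\dots\otimes\mathcal L_m^{\otimes n_m}$ is associated to the representation $(\{G^{[n]}_{ij}\},\{M^{(0)}_i\})_{\mathfrak U}$, where $$G^{[n]}_{ij}=\big(K^{(1)}_{ij}(n_1)\big)^{|n_1|}\cdots\big(K^{(m)}_{ij}(n_m)\big)^{|n_m|}\begin{pmatrix}1&0\\0&\xi_{ij}\end{pmatrix},$$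 with $K^{(k)}_{ij}(n_k)=K^{(k)+}_{ij}$ if $n_k\ge0$ and $K^{(k)}_{ij}(n_k)=K^{(k)-}_{ij}$ if $n_k<0$. In particular the matrices $G^{[n]}_{ij}$ are transition functions of $\phi_*(\mathcal L_1^{\otimes n_1}\otimes\dots\otimes\mathcal L_m^{\otimes n_m})$. -/

import Mathlib

open CategoryTheory AlgebraicGeometry Opposite

noncomputable section

namespace DoubleCover

/-! ### Sheaves of modules: structure sheaf, tensor product, dual, tensor powers -/

section Modules

variable {X : Scheme.{0}}

/-- The structure sheaf, as a sheaf of modules over itself. -/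
def structureSheaf (X : Scheme.{0}) : X.Modules :=
  SheafOfModules.unit X.ringCatSheaf

/-- The sheaf of modules associated to a presheaf of modules. -/
def sheafify (P : X.PresheafOfModules) : X.Modules :=
  (PresheafOfModules.sheafification (𝟙 X.ringCatSheaf.obj)).obj P

/-- The presheaf `V ↦ Γ(A, V) ⊗ Γ(B, V)`. -/
def tensorPresheaf (A B : X.Modules) : X.PresheafOfModules :=
  MonoidalCategory.tensorObj
    (C := PresheafOfModules.{0} (X.presheaf ⋙ forget₂ CommRingCat RingCat))
    ((Scheme.Modules.toPresheafOfModules X).obj A) ((Scheme.Modules.toPresheafOfModules X).obj B)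

/-- The tensor product `A ⊗ B` of two sheaves of `𝒪_X`-modules. -/
def tensor (A B : X.Modules) : X.Modules :=
  sheafify (tensorPresheaf A B)

/-- Restriction of sections of `M` from `V` to `W ⊆ V`. -/
def resM (M : X.Modules) {V W : X.Opens} (h : W ≤ V) : Γ(M, V) →+ Γ(M, W) :=
  (M.presheaf.map (homOfLE h).op).hom

/-- Restriction of regular functions from `V` to `W ⊆ V`. -/
def resO {V W : X.Opens} (h : W ≤ V) : Γ(X, V) →+* Γ(X, W) :=
  (X.presheaf.map (homOfLE h).op).hom

lemma resM_smul (M : X.Modules) {V W : X.Opens} (h : W ≤ V) (r : Γ(X, V)) (x : Γ(M, V)) :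
    resM M h (r • x) = resO h r • resM M h x :=
  Scheme.Modules.map_smul M (homOfLE h) r x

lemma resO_resO {V W T : X.Opens} (h : W ≤ V) (k : T ≤ W) (r : Γ(X, V)) :
    resO k (resO h r) = resO (k.trans h) r := by
  have := X.presheaf.map_comp (homOfLE h).op (homOfLE k).op
  exact (congrArg (fun f => f.hom r) this).symm

/-- Homomorphisms `L|_U → 𝒪_U` of sheaves of modules on `U`: families of linear maps on the
sections over all open `V ⊆ U`, compatible with restriction. -/
@[ext]
structure DualSection (L : X.Modules) (U : X.Opens) where
  app : ∀ V : X.Opens, V ≤ U → Γ(L, V) →ₗ[Γ(X, V)] Γ(X, V)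
  app_res : ∀ (V W : X.Opens) (hV : V ≤ U) (h : W ≤ V) (x : Γ(L, V)),
    app W (h.trans hV) (resM L h x) = resO h (app V hV x)

namespace DualSection

variable {L : X.Modules} {U : X.Opens}

instance : Zero (DualSection L U) := ⟨⟨fun _ _ => 0, by simp⟩⟩

instance : Add (DualSection L U) :=
  ⟨fun f g => ⟨fun V h => f.app V h + g.app V h, fun V W hV h x => by
    simp [f.app_res V W hV h, g.app_res V W hV h]⟩⟩

instance : Neg (DualSection L U) :=
  ⟨fun f => ⟨fun V h => -f.app V h, fun V W hV h x => by simp [f.app_res V W hV h]⟩⟩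

instance : SMul Γ(X, U) (DualSection L U) :=
  ⟨fun r f => ⟨fun V h => resO h r • f.app V h, fun V W hV h x => by
    simp [f.app_res V W hV h, resO_resO]⟩⟩

instance : AddCommGroup (DualSection L U) where
  add_assoc f g h := by ext1; funext V hV; exact add_assoc _ _ _
  zero_add f := by ext1; funext V hV; exact zero_add _
  add_zero f := by ext1; funext V hV; exact add_zero _
  add_comm f g := by ext1; funext V hV; exact add_comm _ _
  neg_add_cancel f := by ext1; funext V hV; exact neg_add_cancel _
  nsmul := nsmulRec
  zsmul := zsmulRec

instance : Module Γ(X, U) (DualSection L U) where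
  one_smul f := by
    ext1; funext V hV
    change resO hV 1 • f.app V hV = _
    rw [map_one, one_smul]
  mul_smul r s f := by
    ext1; funext V hV
    change resO hV (r * s) • f.app V hV = resO hV r • resO hV s • f.app V hV
    rw [map_mul, mul_smul]
  smul_zero r := by ext1; funext V hV; exact smul_zero _
  smul_add r f g := by ext1; funext V hV; exact smul_add _ _ _
  add_smul r s f := by
    ext1; funext V hV
    change resO hV (r + s) • f.app V hV = resO hV r • f.app V hV + resO hV s • f.app V hV
    rw [map_add, add_smul]
  zero_smul f := by
    ext1; funext V hV
    change resO hV 0 • f.app V hV = 0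
    rw [map_zero, zero_smul]

/-- Restriction of a homomorphism `L|_U → 𝒪_U` to a smaller open set. -/
def restrict {W : X.Opens} (h : W ≤ U) : DualSection L U →+ DualSection L W where
  toFun f := ⟨fun V hV => f.app V (hV.trans h), fun V T hV k x => f.app_res V T (hV.trans h) k x⟩
  map_zero' := rfl
  map_add' _ _ := rfl

lemma restrict_smul {W : X.Opens} (h : W ≤ U) (r : Γ(X, U)) (f : DualSection L U) :
    restrict h (r • f) = resO h r • restrict h f := by
  ext1; funext V hV
  change resO (hV.trans h) r • f.app V _ = resO hV (resO h r) • f.app V _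
  rw [resO_resO]

end DualSection

/-- The abelian presheaf `U ↦ Hom(L|_U, 𝒪_U)`. -/
def dualAbPresheaf (L : X.Modules) : (X.Opens)ᵒᵖ ⥤ Ab.{0} where
  obj U := AddCommGrpCat.of (DualSection L U.unop)
  map f := AddCommGrpCat.ofHom (DualSection.restrict f.unop.le)
  map_id _ := rfl
  map_comp _ _ := rfl

instance (L : X.Modules) (U : (X.Opens)ᵒᵖ) :
    Module (X.ringCatSheaf.obj.obj U) ((dualAbPresheaf L).obj U) :=
  inferInstanceAs (Module Γ(X, U.unop) (DualSection L U.unop))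

/-- The presheaf of modules `U ↦ Hom(L|_U, 𝒪_U)`. -/
def dualPresheaf (L : X.Modules) : X.PresheafOfModules :=
  PresheafOfModules.ofPresheaf (R := X.ringCatSheaf.obj) (dualAbPresheaf L)
    fun _ _ f r m => DualSection.restrict_smul f.unop.le r m

/-- The dual `ℋom(L, 𝒪_X)`; for an invertible sheaf `L` it is `L⁻¹`. (`dualPresheaf L` is already
a sheaf, so that sheafifying it only changes it by an isomorphism.) -/
def dual (L : X.Modules) : X.Modules :=
  sheafify (dualPresheaf L)

/-- `L^{⊗ n}` for a natural number `n`. -/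
def tensorPow (L : X.Modules) : ℕ → X.Modules
  | 0 => structureSheaf X
  | n + 1 => tensor L (tensorPow L n)

/-- `L^{⊗ n}` for an integer `n`, with `L^{⊗ -n} = (L⁻¹)^{⊗ n}`. -/
def tensorZPow (L : X.Modules) : ℤ → X.Modules
  | Int.ofNat n => tensorPow L n
  | Int.negSucc n => tensorPow (dual L) (n + 1)

/-- `L_1^{⊗ n_1} ⊗ ⋯ ⊗ L_m^{⊗ n_m}`. -/
def multiPow {m : ℕ} (L : Fin m → X.Modules) (n : Fin m → ℤ) : X.Modules :=
  (List.ofFn fun k => tensorZPow (L k) (n k)).foldr tensor (structureSheaf X)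

/-! ### Local trivializations and transition functions -/

/-- An isomorphism `M|_U ≅ 𝒪_U^{⊕ r}` of sheaves of modules on `U`. -/
structure LocalTriv (M : X.Modules) (U : X.Opens) (r : ℕ) where
  equiv : ∀ V : X.Opens, V ≤ U → Γ(M, V) ≃ₗ[Γ(X, V)] (Fin r → Γ(X, V))
  equiv_res : ∀ (V W : X.Opens) (hV : V ≤ U) (h : W ≤ V) (x : Γ(M, V)) (a : Fin r),
    equiv W (h.trans hV) (resM M h x) a = resO h (equiv V hV x a)

/-- `M` is locally free of rank `r`. -/
def IsLocallyFreeOfRank (M : X.Modules) (r : ℕ) : Prop :=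
  ∀ x : X, ∃ U : X.Opens, x ∈ U ∧ Nonempty (LocalTriv M U r)

/-- The matrix of `φ ∘ ψ⁻¹ : 𝒪^{⊕ r} → 𝒪^{⊕ r}` over `U ∩ V`. -/
def LocalTriv.transition {M : X.Modules} {U V : X.Opens} {r : ℕ} (φ : LocalTriv M U r)
    (ψ : LocalTriv M V r) : Matrix (Fin r) (Fin r) Γ(X, U ⊓ V) :=
  LinearMap.toMatrix'
    ((φ.equiv (U ⊓ V) inf_le_left).toLinearMap ∘ₗ (ψ.equiv (U ⊓ V) inf_le_right).symm.toLinearMap)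

/-- A morphism of sheaves of modules `A ⊗ B → C`, given (by the universal property of the tensor
product) as a compatible family of bilinear maps on sections. -/
structure Pairing (A B C : X.Modules) where
  app : ∀ U : X.Opens, Γ(A, U) →ₗ[Γ(X, U)] Γ(B, U) →ₗ[Γ(X, U)] Γ(C, U)
  app_res : ∀ (U V : X.Opens) (h : V ≤ U) (a : Γ(A, U)) (b : Γ(B, U)),
    app V (resM A h a) (resM B h b) = resM C h (app U a b)

/-- Sections of the structure sheaf are regular functions. -/
def toFun (U : X.Opens) (s : Γ(structureSheaf X, U)) : Γ(X, U) := s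

end Modules

/-! ### Non-singular double covers -/

/-- A scheme with structure morphism `p` to `Spec ℂ` is a non-singular variety over `ℂ`. -/
structure IsNonsingularVariety {X : Scheme.{0}} (p : X ⟶ Spec (CommRingCat.of ℂ)) : Prop where
  isIntegral : IsIntegral X
  separated : IsSeparated p
  locallyOfFiniteType : LocallyOfFiniteType p
  quasiCompact : QuasiCompact p
  smooth : Smooth p

/-- The degree `[K(X) : K(Y)]` of a dominant morphism `φ : X ⟶ Y` of integral schemes: the rank
of the stalk of `𝒪_X` at the generic point of `X` over the stalk of `𝒪_Y` at its image. -/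
def degree {X Y : Scheme.{0}} [IrreducibleSpace X] (φ : X ⟶ Y) : ℕ :=
  letI := (φ.stalkMap (genericPoint X)).hom.toAlgebra
  Module.finrank (Y.presheaf.stalk (φ (genericPoint X))) (X.presheaf.stalk (genericPoint X))

/-- `φ : X ⟶ Y` is a finite surjective morphism of degree `2` over `ℂ` between non-singular
varieties over `ℂ`. -/
structure IsNonsingularDoubleCover {X Y : Scheme.{0}} (p : X ⟶ Spec (CommRingCat.of ℂ))
    (q : Y ⟶ Spec (CommRingCat.of ℂ)) (φ : X ⟶ Y) : Prop where
  source : IsNonsingularVariety p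
  target : IsNonsingularVariety q
  comp_eq : φ ≫ q = p
  finite : IsFinite φ
  surjective : Surjective φ
  degree_eq : haveI := source.isIntegral; degree φ = 2

/-- A presentation of `φ_* 𝒪_X` as the `𝒪_Y`-algebra `(⨁_n tⁿ 𝒪_Y(-nL)) / (t² - F)`. -/
structure Presentation {X Y : Scheme.{0}} (φ : X ⟶ Y) where
  /-- the invertible sheaf `𝒪_Y(-L)` -/
  N : Y.Modules
  isLocallyFree : IsLocallyFreeOfRank N 1
  /-- `𝒪_Y(-L) → φ_* 𝒪_X`, `s ↦ s t` -/
  t : N ⟶ (Scheme.Modules.pushforward φ).obj (structureSheaf X)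
  /-- the section `F` of `𝒪_Y(2L)`, as a morphism `𝒪_Y(-L) ⊗ 𝒪_Y(-L) → 𝒪_Y` -/
  F : Pairing N N (structureSheaf Y)
  /-- `φ_* 𝒪_X = 𝒪_Y ⊕ 𝒪_Y(-L) t` -/
  bijective : ∀ U : Y.Opens, Function.Bijective fun z : Γ(Y, U) × Γ(N, U) =>
    (φ.app U).hom z.1 + toFun (φ ⁻¹ᵁ U) (t.app U z.2)
  /-- `t² = F` -/
  mul_eq : ∀ (U : Y.Opens) (s s' : Γ(N, U)),
    toFun (φ ⁻¹ᵁ U) (t.app U s) * toFun (φ ⁻¹ᵁ U) (t.app U s') =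
      (φ.app U).hom (toFun U (F.app U s s'))

variable {X Y : Scheme.{0}} {φ : X ⟶ Y}

/-- The regular function `s t` on `φ⁻¹(U)`, for a section `s` of `𝒪_Y(-L)` over `U`. -/
def Presentation.mulT (D : Presentation φ) {U : Y.Opens} (s : Γ(D.N, U)) : Γ(X, φ ⁻¹ᵁ U) :=
  toFun (φ ⁻¹ᵁ U) (D.t.app U s)

/-- Multiplication by `t`, as a map `(φ_* 𝓛)(-L) → φ_* 𝓛` on local sections:
`x ⊗ s ↦ (s t) x`. -/
def Presentation.actT (D : Presentation φ) (𝓛 : X.Modules) {U : Y.Opens}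
    (x : Γ((Scheme.Modules.pushforward φ).obj 𝓛, U)) (s : Γ(D.N, U)) :
    Γ((Scheme.Modules.pushforward φ).obj 𝓛, U) :=
  (D.mulT s • (show Γ(𝓛, φ ⁻¹ᵁ U) from x) : Γ(𝓛, φ ⁻¹ᵁ U))

/-- An admissible pair `(𝓜, M)`: a `2`-bundle `𝓜` on `Y` with `M : 𝓜(-L) → 𝓜` such that
`M² = F · id`. -/
structure AdmissiblePair (D : Presentation φ) where
  bundle : Y.Modules
  isLocallyFree : IsLocallyFreeOfRank bundle 2
  map : Pairing bundle D.N bundle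
  map_map : ∀ (U : Y.Opens) (x : Γ(bundle, U)) (s s' : Γ(D.N, U)),
    map.app U (map.app U x s) s' = toFun U (D.F.app U s s') • x

/-- The line bundle `𝓛` on `X` is associated to `(𝓜, M)`: there is an isomorphism
`φ_* 𝓛 ≅ 𝓜` under which multiplication by `t` corresponds to `M`. -/
def AdmissiblePair.IsAssociated {D : Presentation φ} (P : AdmissiblePair D) (𝓛 : X.Modules) :
    Prop :=
  IsLocallyFreeOfRank 𝓛 1 ∧
    ∃ Ψ : (Scheme.Modules.pushforward φ).obj 𝓛 ≅ P.bundle,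
      ∀ (U : Y.Opens) (x : Γ((Scheme.Modules.pushforward φ).obj 𝓛, U)) (s : Γ(D.N, U)),
        Ψ.hom.app U (D.actT 𝓛 x s) = P.map.app U (Ψ.hom.app U x) s

/-- An affine open covering `{U_i}` of `Y` with isomorphisms `𝒪_Y(-L)|_{U_i} ≅ 𝒪_{U_i}`. -/
structure TrivCover (D : Presentation φ) (I : Type*) where
  U : I → Y.Opens
  affine : ∀ i, IsAffineOpen (U i)
  iSup_eq_top : ⨆ i, U i = ⊤
  triv : ∀ i, LocalTriv D.N (U i) 1

namespace TrivCover

variable {D : Presentation φ} {I : Type*} (𝔘 : TrivCover D I)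

/-- The generator of `𝒪_Y(-L)` on `U_i`; its image in `φ_* 𝒪_X` is `t_i`. -/
def gen (i : I) : Γ(D.N, 𝔘.U i) :=
  ((𝔘.triv i).equiv (𝔘.U i) le_rfl).symm fun _ => 1

/-- The transition functions `ξ_ij` of `𝒪_Y(-L)`, so that `t_j = t_i ξ_ij`. -/
def xi (i j : I) : Γ(Y, 𝔘.U i ⊓ 𝔘.U j) :=
  (𝔘.triv i).transition (𝔘.triv j) 0 0

/-- The local equation `F_i = t_i²` of the branch locus. -/
def Floc (i : I) : Γ(Y, 𝔘.U i) :=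
  toFun (𝔘.U i) (D.F.app (𝔘.U i) (𝔘.gen i) (𝔘.gen i))

/-- Families `{G_ij}` of `2 × 2` matrices over `U_i ∩ U_j`. -/
abbrev Mat₂ : Type _ := ∀ i j : I, Matrix (Fin 2) (Fin 2) Γ(Y, 𝔘.U i ⊓ 𝔘.U j)

/-- Families `{M_i}` of `2 × 2` matrices over `U_i`. -/
abbrev Mat₁ : Type _ := ∀ i : I, Matrix (Fin 2) (Fin 2) Γ(Y, 𝔘.U i)

/-- `G⁽⁰⁾_ij = diag(1, ξ_ij)`. -/
def G₀ : 𝔘.Mat₂ := fun i j => !![1, 0; 0, 𝔘.xi i j]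

/-- The normal matrix `M⁽⁰⁾_i`. -/
def M₀ : 𝔘.Mat₁ := fun i => !![0, 𝔘.Floc i; 1, 0]

end TrivCover

/-- Trivializations `φ_i : 𝓜|_{U_i} ≅ 𝒪_{U_i}^{⊕ 2}` of the bundle of an admissible pair. -/
structure Representation {D : Presentation φ} (P : AdmissiblePair D) {I : Type*}
    (𝔘 : TrivCover D I) where
  triv : ∀ i, LocalTriv P.bundle (𝔘.U i) 2

namespace Representation

variable {D : Presentation φ} {P : AdmissiblePair D} {I : Type*} {𝔘 : TrivCover D I}

/-- The transition functions `G_ij = φ_i ∘ φ_j⁻¹`. -/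
def G (R : Representation P 𝔘) : 𝔘.Mat₂ := fun i j => (R.triv i).transition (R.triv j)

/-- The matrices `M_i = φ_i ∘ M ∘ φ_i(-L)⁻¹`. -/
def M (R : Representation P 𝔘) : 𝔘.Mat₁ := fun i =>
  LinearMap.toMatrix'
    (((R.triv i).equiv (𝔘.U i) le_rfl).toLinearMap ∘ₗ
      (P.map.app (𝔘.U i)).flip (𝔘.gen i) ∘ₗ
        ((R.triv i).equiv (𝔘.U i) le_rfl).symm.toLinearMap)

/-- A representation is good if the lower left entry `a_i1` of every `M_i` is a unit. -/
def IsGood (R : Representation P 𝔘) : Prop := ∀ i, IsUnit (R.M i 1 0)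

end Representation

/-- `𝓛` is associated to the representation `({G_ij}, {M_i})`. -/
def IsAssociatedToRep {D : Presentation φ} {I : Type*} (𝔘 : TrivCover D I) (𝓛 : X.Modules)
    (G : 𝔘.Mat₂) (M : 𝔘.Mat₁) : Prop :=
  ∃ (P : AdmissiblePair D) (R : Representation P 𝔘), P.IsAssociated 𝓛 ∧ R.G = G ∧ R.M = M

/-! ### The matrices of the group law -/

namespace TrivCover

variable {D : Presentation φ} {I : Type*} (𝔘 : TrivCover D I)

/-- Restriction of functions from `U_i` to `U_i ∩ U_j`. -/
def res (i j : I) : Γ(Y, 𝔘.U i) →+* Γ(Y, 𝔘.U i ⊓ 𝔘.U j) := resO inf_le_left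

/-- `K⁺_ij = a_i1⁻¹ ((a_i1 g_ij,11 - a_i0 g_ij,21) E + g_ij,21 M⁽⁰⁾_i)`, where
`a_i0 = (M_i)_11` and `a_i1 = (M_i)_21`. -/
def Kplus (G : 𝔘.Mat₂) (M : 𝔘.Mat₁) : 𝔘.Mat₂ := fun i j =>
  let a₀ := 𝔘.res i j (M i 0 0)
  let a₁ := 𝔘.res i j (M i 1 0)
  Ring.inverse a₁ •
    ((a₁ * G i j 0 0 - a₀ * G i j 1 0) • (1 : Matrix (Fin 2) (Fin 2) Γ(Y, 𝔘.U i ⊓ 𝔘.U j)) +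
      G i j 1 0 • (𝔘.M₀ i).map (𝔘.res i j))

/-- `K⁻_ij = ξ_ij (a_i1 det G_ij)⁻¹ ((a_i1 g_ij,11 - a_i0 g_ij,21) E - g_ij,21 M⁽⁰⁾_i)`. -/
def Kminus (G : 𝔘.Mat₂) (M : 𝔘.Mat₁) : 𝔘.Mat₂ := fun i j =>
  let a₀ := 𝔘.res i j (M i 0 0)
  let a₁ := 𝔘.res i j (M i 1 0)
  (𝔘.xi i j * Ring.inverse (a₁ * (G i j).det)) •
    ((a₁ * G i j 0 0 - a₀ * G i j 1 0) • (1 : Matrix (Fin 2) (Fin 2) Γ(Y, 𝔘.U i ⊓ 𝔘.U j)) -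
      G i j 1 0 • (𝔘.M₀ i).map (𝔘.res i j))

/-- `K_ij(n)`, which is `K⁺_ij` for `n ≥ 0` and `K⁻_ij` for `n < 0`. -/
def K (G : 𝔘.Mat₂) (M : 𝔘.Mat₁) (n : ℤ) : 𝔘.Mat₂ :=
  if 0 ≤ n then 𝔘.Kplus G M else 𝔘.Kminus G M

/-- `K⁽¹⁾_ij(n_1)^|n_1| ⋯ K⁽ᵐ⁾_ij(n_m)^|n_m| G⁽⁰⁾_ij`. -/
def groupLawG {m : ℕ} (G : Fin m → 𝔘.Mat₂) (M : Fin m → 𝔘.Mat₁) (n : Fin m → ℤ) : 𝔘.Mat₂ :=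
  fun i j => (List.ofFn fun k => 𝔘.K (G k) (M k) (n k) i j ^ (n k).natAbs).prod * 𝔘.G₀ i j

end TrivCover

end DoubleCover

end

/-! Goodness of a representation makes the first basis vector a local generator of the line bundle.
Over `U_i` let `e_i` be the section of `𝓛` corresponding to the first basis vector. Then `t_i e_i`
corresponds to `a_i0` times the first basis vector plus `a_i1` times the second. Since `a_i1` is a
unit, `e_i` and `t_i e_i` form an `𝒪_Y(U_i)`-basis, so `e_i` spans the sections of `𝓛` over the
affine open set `φ⁻¹(U_i)`, hence generates `𝓛` there (`isGenerator_of_surjective`).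

Expanding `e_j` in this basis gives `e_j = x_ij e_i` with `x_ij = a_i1⁻¹ ((a_i1 g_11 - a_i0 g_21) +
g_21 t_i)`, and `K⁺_ij` is the matrix of multiplication by `x_ij` in the basis `1, t_i`
(`AdmissiblePair.IsAssociated.hasCocycle`, `actsAs_Kplus`).

`K⁻_ij` is multiplication by a multiple `y_ij` of the conjugate of `x_ij`, scaled so that `x_ij y_ij
= a_j1 / a_i1`. The right-hand side is a coboundary, so `y_ij` describes the dual of `𝓛` in rescaled
dual generators (`HasCocycle.dual`). The scaling rests on the norm identity
`norm_mul_eq_of_mul_eq_smul`.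

Under tensor products these functions multiply, and so do their matrices. Finally, a line bundle `A`
with generators `w_j = z_ij w_i` over the `φ⁻¹(U_i)` has a direct image with local bases `w_i, t_i
w_i`. Its transition matrix is that of multiplication by `z_ij` times `diag(1, ξ_ij)`, and `t_i`
acts by the normal matrix (`isAssociatedToRep_of_hasCocycle`). -/

noncomputable section

namespace DoubleCover

/-! ### Gluing, and local generators of sheaves of modules. -/

section Generators

variable {X : Scheme.{0}}

lemma resO_self {V : X.Opens} (r : Γ(X, V)) : resO le_rfl r = r :=
  congrArg (fun f => f.hom r) (X.presheaf.map_id (op V))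

lemma resM_self (M : X.Modules) {V : X.Opens} (x : Γ(M, V)) : resM M le_rfl x = x :=
  congrArg (fun f => f.hom x) (M.presheaf.map_id (op V))

lemma resM_resM (M : X.Modules) {V W T : X.Opens} (h : W ≤ V) (k : T ≤ W) (x : Γ(M, V)) :
    resM M k (resM M h x) = resM M (k.trans h) x := by
  have := M.presheaf.map_comp (homOfLE h).op (homOfLE k).op
  exact (congrArg (fun f => f.hom x) this).symm

lemma exists_glue (M : X.Modules) {ι : Type} (U : ι → X.Opens) (V : X.Opens) (hU : ∀ i, U i ≤ V)
    (hV : V ≤ ⨆ i, U i) (s : ∀ i, Γ(M, U i))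
    (hs : ∀ i j, resM M inf_le_left (s i) = resM M (inf_le_right : U i ⊓ U j ≤ U j) (s j)) :
    ∃ t : Γ(M, V), ∀ i, resM M (hU i) t = s i := by
  obtain ⟨t, ht, -⟩ := TopCat.Sheaf.existsUnique_gluing' ⟨M.presheaf, M.isSheaf⟩ U V
    (fun i => homOfLE (hU i)) hV s hs
  exact ⟨t, ht⟩

lemma eq_of_cover (M : X.Modules) {ι : Type} (U : ι → X.Opens) (V : X.Opens) (hU : ∀ i, U i ≤ V)
    (hV : V ≤ ⨆ i, U i) (s t : Γ(M, V)) (hs : ∀ i, resM M (hU i) s = resM M (hU i) t) : s = t :=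
  TopCat.Sheaf.eq_of_locally_eq' ⟨M.presheaf, M.isSheaf⟩ U V
    (fun i => homOfLE (hU i)) hV s t hs

/-- `w` generates `M` over `U`: multiplication by `w` is an isomorphism `𝒪_U ≅ M|_U`. -/
def IsGenerator (M : X.Modules) {U : X.Opens} (w : Γ(M, U)) : Prop :=
  ∀ (V : X.Opens) (h : V ≤ U), Function.Bijective fun r : Γ(X, V) => r • resM M h w

/-- The isomorphism `𝒪(V) ≅ M(V)` given by a generator. -/
def IsGenerator.equiv {M : X.Modules} {U : X.Opens} {w : Γ(M, U)} (hw : IsGenerator M w)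
    {V : X.Opens} (h : V ≤ U) : Γ(X, V) ≃ₗ[Γ(X, V)] Γ(M, V) :=
  LinearEquiv.ofBijective (LinearMap.toSpanSingleton Γ(X, V) _ (resM M h w)) (hw V h)

lemma IsGenerator.equiv_symm_smul {M : X.Modules} {U : X.Opens} {w : Γ(M, U)}
    (hw : IsGenerator M w) {V : X.Opens} (h : V ≤ U) (r : Γ(X, V)) :
    (hw.equiv h).symm (r • resM M h w) = r :=
  (hw.equiv h).symm_apply_apply r

lemma IsGenerator.restrict {M : X.Modules} {U V : X.Opens} {w : Γ(M, U)} (hw : IsGenerator M w)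
    (h : V ≤ U) : IsGenerator M (resM M h w) := by
  intro W k
  simpa only [resM_resM] using hw W (k.trans h)

lemma IsGenerator.unit_smul {M : X.Modules} {U : X.Opens} {w : Γ(M, U)} (hw : IsGenerator M w)
    {u : Γ(X, U)} (hu : IsUnit u) : IsGenerator M (u • w) := by
  intro V h
  simp only [resM_smul, smul_smul]
  exact (hw V h).comp (IsUnit.isUnit_iff_mulRight_bijective.mp (hu.map (resO h)))

lemma isGenerator_one (U : X.Opens) :
    IsGenerator (structureSheaf X) (show Γ(structureSheaf X, U) from (1 : Γ(X, U))) := by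
  intro V h
  have : (fun r : Γ(X, V) => r • resM (structureSheaf X) h
      (show Γ(structureSheaf X, U) from (1 : Γ(X, U)))) = fun r => r := by
    funext r
    change r * resO h 1 = r
    rw [map_one, mul_one]
  rw [this]
  exact Function.bijective_id

/-- Uniqueness of the coefficient is a local question, and uniqueness on overlaps lets locally found
coefficients glue. -/
lemma isGenerator_of_cover (M : X.Modules) {U : X.Opens} (w : Γ(M, U))
    (H : ∀ x ∈ U, ∃ (V : X.Opens) (h : V ≤ U), x ∈ V ∧ IsGenerator M (resM M h w)) :
    IsGenerator M w := by
  choose! V hVU hxV hV using H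
  intro T hT
  have hcov : T ≤ ⨆ x : T, (V x ⊓ T) := fun x hx => by
    simp only [TopologicalSpace.Opens.mem_iSup]
    exact ⟨⟨x, hx⟩, hxV x (hT hx), hx⟩
  have hle : ∀ x : T, V x ⊓ T ≤ U := fun x => inf_le_right.trans hT
  have key : ∀ (x : T) (W : X.Opens) (hW : W ≤ V x ⊓ T),
      Function.Bijective fun r : Γ(X, W) => r • resM M (hW.trans (hle x)) w := by
    intro x W hW
    have := hV x (hT x.2) W (hW.trans inf_le_left)
    simpa only [resM_resM] using this
  constructor
  · intro r s hrs
    refine eq_of_cover (structureSheaf X) (fun x : T => V x ⊓ T) T (fun _ => inf_le_right) hcov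
      r s fun x => ?_
    apply (key x _ le_rfl).1
    have := congrArg (resM M (inf_le_right : V x ⊓ T ≤ T)) hrs
    simp only [resM_smul, resM_resM] at this
    exact this
  · intro z
    choose r hr using fun x : T => (key x _ le_rfl).2 (resM M inf_le_right z)
    obtain ⟨t, ht⟩ := exists_glue (structureSheaf X) (fun x : T => V x ⊓ T) T
      (fun _ => inf_le_right) hcov r fun x y => by
        apply (key x _ inf_le_left).1
        have h1 := congrArg (resM M (inf_le_left : (V x ⊓ T) ⊓ (V y ⊓ T) ≤ _)) (hr x)
        have h2 := congrArg (resM M (inf_le_right : (V x ⊓ T) ⊓ (V y ⊓ T) ≤ _)) (hr y)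
        simp only [resM_smul, resM_resM] at h1 h2
        exact h1.trans h2.symm
    refine ⟨t, eq_of_cover M (fun x : T => V x ⊓ T) T (fun _ => inf_le_right) hcov _ _
      fun x => ?_⟩
    have := hr x
    rw [← ht x] at this
    refine (resM_smul M _ (toFun T t) _).trans ?_
    rw [resM_resM]
    exact this

end Generators

/-! ### Generators of an associated sheaf. -/

section Sheafification

variable {X : Scheme.{0}}

/-- Restriction of sections of a presheaf of modules from `V` to `W ⊆ V`. -/
def resP (P : X.PresheafOfModules) {V W : X.Opens} (h : W ≤ V) (x : P.obj (op V)) :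
    P.obj (op W) :=
  P.presheaf.map (homOfLE h).op x

instance (P : X.PresheafOfModules) (V : X.Opens) : Module Γ(X, V) (P.obj (op V)) :=
  inferInstanceAs (Module (X.ringCatSheaf.obj.obj (op V)) (P.obj (op V)))

lemma resP_smul (P : X.PresheafOfModules) {V W : X.Opens} (h : W ≤ V) (r : Γ(X, V))
    (x : P.obj (op V)) : resP P h (r • x) = resO h r • resP P h x :=
  P.map_smul _ _ _

/-- The canonical map from a presheaf of modules to the associated sheaf, on sections. -/
def unitApp (P : X.PresheafOfModules) (V : X.Opens) : P.obj (op V) →ₗ[Γ(X, V)] Γ(sheafify P, V) :=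
  (((PresheafOfModules.sheafificationAdjunction (𝟙 X.ringCatSheaf.obj)).unit.app P).app (op V)).hom

lemma unitApp_res (P : X.PresheafOfModules) {V W : X.Opens} (h : W ≤ V) (x : P.obj (op V)) :
    unitApp P W (resP P h x) = resM (sheafify P) h (unitApp P V x) :=
  PresheafOfModules.naturality_apply
    ((PresheafOfModules.sheafificationAdjunction (𝟙 X.ringCatSheaf.obj)).unit.app P)
    (homOfLE h).op x

/-- On underlying abelian presheaves the unit is `toSheafify`, so sections with equal image agree on
a covering sieve. -/
lemma unitApp_locally_injective (P : X.PresheafOfModules) {V : X.Opens} (x y : P.obj (op V))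
    (h : unitApp P V x = unitApp P V y) (p : X) (hp : p ∈ V) :
    ∃ (W : X.Opens) (hW : W ≤ V), p ∈ W ∧ resP P hW x = resP P hW y := by
  obtain ⟨W, f, hf, hpW⟩ := CategoryTheory.Presheaf.equalizerSieve_mem
    (Opens.grothendieckTopology X)
    (CategoryTheory.toSheafify (Opens.grothendieckTopology X) P.presheaf) x y h p hp
  exact ⟨W, f.le, hpW, hf⟩

lemma unitApp_locally_surjective (P : X.PresheafOfModules) {V : X.Opens} (z : Γ(sheafify P, V))
    (p : X) (hp : p ∈ V) :
    ∃ (W : X.Opens) (hW : W ≤ V) (x : P.obj (op W)), p ∈ W ∧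
      unitApp P W x = resM (sheafify P) hW z := by
  obtain ⟨W, f, ⟨x, hx⟩, hpW⟩ := CategoryTheory.Presheaf.imageSieve_mem
    (Opens.grothendieckTopology X)
    (CategoryTheory.toSheafify (Opens.grothendieckTopology X) P.presheaf) (U := op V) z p hp
  exact ⟨W, f.le, x, hpW, hx⟩

lemma resP_resP (P : X.PresheafOfModules) {V W T : X.Opens} (h : W ≤ V) (k : T ≤ W)
    (x : P.obj (op V)) : resP P k (resP P h x) = resP P (k.trans h) x := by
  have := P.presheaf.map_comp (homOfLE h).op (homOfLE k).op
  exact (congrArg (fun f => f.hom x) this).symm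

/-- This reduces tensor products and duals to their presheaves: sections of the sheaf come locally
from the presheaf, where the coefficient is known, and these coefficients glue. -/
lemma isGenerator_unitApp (P : X.PresheafOfModules) {U : X.Opens} (w : P.obj (op U))
    (hw : ∀ (V : X.Opens) (h : V ≤ U), Function.Bijective fun r : Γ(X, V) => r • resP P h w) :
    IsGenerator (sheafify P) (unitApp P U w) := by
  have key : ∀ (V : X.Opens) (h : V ≤ U) (r : Γ(X, V)),
      r • resM (sheafify P) h (unitApp P U w) = unitApp P V (r • resP P h w) := by
    intro V h r
    rw [map_smul, unitApp_res]
  have inj : ∀ (V : X.Opens) (h : V ≤ U),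
      Function.Injective fun r : Γ(X, V) => r • resM (sheafify P) h (unitApp P U w) := by
    intro V h r s hrs
    simp only [key] at hrs
    choose W hWV hpW hW using fun p : V => unitApp_locally_injective P _ _ hrs p p.2
    refine eq_of_cover (structureSheaf X) W V hWV
      (fun p hp => TopologicalSpace.Opens.mem_iSup.2 ⟨⟨p, hp⟩, hpW _⟩) r s fun p => ?_
    apply (hw _ ((hWV p).trans h)).1
    have := hW p
    simp only [resP_smul, resP_resP] at this
    exact this
  refine fun V h => ⟨inj V h, fun z => ?_⟩
  choose W hWV x hpW hx using fun p : V => unitApp_locally_surjective P z p p.2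
  choose r hr using fun p : V => (hw (W p) ((hWV p).trans h)).2 (x p)
  have hz : ∀ p, r p • resM (sheafify P) ((hWV p).trans h) (unitApp P U w) =
      resM (sheafify P) (hWV p) z := by
    intro p
    rw [key, ← hx p]
    exact congrArg _ (hr p)
  have hcov : V ≤ ⨆ p, W p := fun p hp => TopologicalSpace.Opens.mem_iSup.2 ⟨⟨p, hp⟩, hpW _⟩
  obtain ⟨t, ht⟩ := exists_glue (structureSheaf X) W V hWV hcov r fun p q => by
    apply inj _ (inf_le_left.trans ((hWV p).trans h))
    have h1 := congrArg (resM _ (inf_le_left : W p ⊓ W q ≤ _)) (hz p)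
    have h2 := congrArg (resM _ (inf_le_right : W p ⊓ W q ≤ _)) (hz q)
    simp only [resM_smul, resM_resM] at h1 h2
    exact h1.trans h2.symm
  refine ⟨t, eq_of_cover _ W V hWV hcov _ _ fun p => ?_⟩
  have := hz p
  rw [← ht p] at this
  refine (resM_smul _ _ (toFun V t) _).trans ?_
  rw [resM_resM]
  exact this

end Sheafification

/-! ### Generators of tensor products. -/

section Tensor

variable {X : Scheme.{0}} (A B : X.Modules)

/-- The local section `a ⊗ b` of `A ⊗ B`. -/
def tmul {U : X.Opens} (a : Γ(A, U)) (b : Γ(B, U)) : Γ(tensor A B, U) :=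
  unitApp (tensorPresheaf A B) U (TensorProduct.tmul Γ(X, U) a b)

lemma tmul_res {U V : X.Opens} (h : V ≤ U) (a : Γ(A, U)) (b : Γ(B, U)) :
    resM _ h (tmul A B a b) = tmul A B (resM A h a) (resM B h b) :=
  (unitApp_res (tensorPresheaf A B) h _).symm

lemma tmul_smul_smul {U : X.Opens} (r s : Γ(X, U)) (a : Γ(A, U)) (b : Γ(B, U)) :
    tmul A B (r • a) (s • b) = (r * s) • tmul A B a b := by
  refine Eq.trans ?_ ((unitApp (tensorPresheaf A B) U).map_smul (r * s) _)
  exact congrArg (unitApp (tensorPresheaf A B) U) (TensorProduct.smul_tmul_smul r s a b)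

lemma isGenerator_tmul {U : X.Opens} {a : Γ(A, U)} {b : Γ(B, U)} (ha : IsGenerator A a)
    (hb : IsGenerator B b) : IsGenerator (tensor A B) (tmul A B a b) := by
  refine isGenerator_unitApp (tensorPresheaf A B) _ fun V h => ?_
  let e := (TensorProduct.lid Γ(X, V) Γ(X, V)).symm.trans
    (TensorProduct.congr (ha.equiv h) (hb.equiv h))
  have : ∀ r, e r = r • (TensorProduct.tmul Γ(X, V) (resM A h a) (resM B h b)) := by
    intro r
    change TensorProduct.tmul Γ(X, V) ((1 : Γ(X, V)) • resM A h a) (r • resM B h b) = _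
    rw [one_smul, TensorProduct.tmul_smul]
  have h2 : (fun r : Γ(X, V) => r • (TensorProduct.tmul Γ(X, V) (resM A h a) (resM B h b))) = e :=
    funext fun r => (this r).symm
  have h3 := e.bijective
  rw [← h2] at h3
  exact h3

end Tensor

/-! ### Generators of duals. -/

section Dual

variable {X : Scheme.{0}} (L : X.Modules)

/-- The generator of the dual of `L` that takes the value `1` at a generator of `L`. -/
def IsGenerator.dualSection {L : X.Modules} {U : X.Opens} {w : Γ(L, U)} (hw : IsGenerator L w) :
    DualSection L U where
  app V h := (hw.equiv h).symm.toLinearMap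
  app_res V W hV h x := by
    obtain ⟨r, rfl⟩ := (hw V hV).2 x
    simp only [LinearEquiv.coe_coe, resM_smul, resM_resM, hw.equiv_symm_smul]

lemma IsGenerator.dualSection_app_smul {L : X.Modules} {U : X.Opens} {w : Γ(L, U)}
    (hw : IsGenerator L w) {V : X.Opens} (h : V ≤ U) (r : Γ(X, V)) :
    hw.dualSection.app V h (r • resM L h w) = r :=
  hw.equiv_symm_smul h r

lemma IsGenerator.dualSection_ext {L : X.Modules} {U : X.Opens} {w : Γ(L, U)}
    (hw : IsGenerator L w) {f g : DualSection L U}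
    (h : f.app U le_rfl w = g.app U le_rfl w) : f = g := by
  ext1
  funext V hV
  ext x
  obtain ⟨r, rfl⟩ := (hw V hV).2 x
  simp only [map_smul, f.app_res U V le_rfl hV, g.app_res U V le_rfl hV, h]

/-- The local section of the dual of `L` defined by a homomorphism `L|_U → 𝒪_U`. -/
def ofDualSection {U : X.Opens} (f : DualSection L U) : Γ(dual L, U) :=
  unitApp (dualPresheaf L) U f

lemma ofDualSection_res {U V : X.Opens} (h : V ≤ U) (f : DualSection L U) :
    resM _ h (ofDualSection L f) = ofDualSection L (DualSection.restrict h f) :=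
  (unitApp_res (dualPresheaf L) h f).symm

lemma ofDualSection_smul {U : X.Opens} (r : Γ(X, U)) (f : DualSection L U) :
    ofDualSection L (r • f) = r • ofDualSection L f :=
  (unitApp (dualPresheaf L) U).map_smul r f

/-- A homomorphism is determined by its value at `w`, so it is that value times the dual section. -/
lemma IsGenerator.ofDualSection {L : X.Modules} {U : X.Opens} {w : Γ(L, U)}
    (hw : IsGenerator L w) : IsGenerator (dual L) (ofDualSection L hw.dualSection) := by
  refine isGenerator_unitApp (dualPresheaf L) _ fun V h => ?_
  change Function.Bijective fun r : Γ(X, V) => r • DualSection.restrict h hw.dualSection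
  have key : ∀ r : Γ(X, V), (r • DualSection.restrict h hw.dualSection).app V le_rfl
      (resM L h w) = r := by
    intro r
    change resO le_rfl r * hw.dualSection.app V h (resM L h w) = r
    have := hw.dualSection_app_smul h 1
    rw [one_smul] at this
    rw [this, mul_one, resO_self]
  constructor
  · intro r s hrs
    rw [← key r, ← key s]
    exact congrArg (fun f : DualSection L V => f.app V le_rfl (resM L h w)) hrs
  · intro f
    refine ⟨f.app V le_rfl (resM L h w), (hw.restrict h).dualSection_ext ?_⟩
    exact key _

end Dual

/-! ### Transition functions of tensor products, duals and powers. -/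

section Cocycles

variable {X : Scheme.{0}}

/-- Both sides take the value `f` at the generator `w'`. Dual generators transform in the opposite
direction, so `f` need not be inverted. -/
lemma IsGenerator.ofDualSection_transition {L : X.Modules} {U V : X.Opens} {w : Γ(L, U)}
    {w' : Γ(L, V)} (hw : IsGenerator L w) (hw' : IsGenerator L w') (f : Γ(X, U ⊓ V))
    (h : resM L inf_le_right w' = f • resM L inf_le_left w) :
    resM _ inf_le_left (DoubleCover.ofDualSection L hw.dualSection) =
      f • resM _ inf_le_right (DoubleCover.ofDualSection L hw'.dualSection) := by
  rw [ofDualSection_res, ofDualSection_res, ← ofDualSection_smul]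
  congr 1
  apply (hw'.restrict inf_le_right).dualSection_ext
  change hw.dualSection.app _ inf_le_left _ = resO le_rfl f * hw'.dualSection.app _ inf_le_right _
  have h1 := hw'.dualSection_app_smul inf_le_right (1 : Γ(X, U ⊓ V))
  rw [one_smul] at h1
  rw [h1, h, hw.dualSection_app_smul, mul_one, resO_self]

variable {I : Type*} {W : I → X.Opens}

/-- `A` has generators `w_i` over the open sets `W_i` such that `w_j = h_ij w_i`. -/
def HasCocycle (A : X.Modules) (W : I → X.Opens) (h : ∀ i j, Γ(X, W i ⊓ W j)) : Prop :=
  ∃ w : ∀ i, Γ(A, W i), (∀ i, IsGenerator A (w i)) ∧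
    ∀ i j, resM A inf_le_right (w j) = h i j • resM A inf_le_left (w i)

lemma hasCocycle_structureSheaf : HasCocycle (structureSheaf X) W fun _ _ => 1 := by
  refine ⟨fun i => (1 : Γ(X, W i)), fun i => isGenerator_one _, fun i j => ?_⟩
  exact (map_one (resO inf_le_right)).trans ((one_mul (1 : Γ(X, W i ⊓ W j))).symm.trans
    (congrArg ((1 : Γ(X, W i ⊓ W j)) * ·) (map_one (resO inf_le_left)).symm))

lemma HasCocycle.tensor {A B : X.Modules} {f g : ∀ i j, Γ(X, W i ⊓ W j)} (hA : HasCocycle A W f)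
    (hB : HasCocycle B W g) : HasCocycle (tensor A B) W fun i j => f i j * g i j := by
  obtain ⟨a, ha, ha'⟩ := hA
  obtain ⟨b, hb, hb'⟩ := hB
  refine ⟨fun i => tmul A B (a i) (b i), fun i => isGenerator_tmul A B (ha i) (hb i),
    fun i j => ?_⟩
  rw [tmul_res, tmul_res, ha', hb', tmul_smul_smul]

/-- The new generators are `v_i` times the dual ones. The factor `v` absorbs the discrepancy between
`g` and the inverse of `f`, which for `K⁻` is a quotient of the units `a_i1`. -/
lemma HasCocycle.dual {A : X.Modules} {f g : ∀ i j, Γ(X, W i ⊓ W j)} (hA : HasCocycle A W f)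
    (v : ∀ i, Γ(X, W i)) (hv : ∀ i, IsUnit (v i))
    (h : ∀ i j, resO inf_le_left (v i) * (f i j * g i j) = resO inf_le_right (v j)) :
    HasCocycle (dual A) W g := by
  obtain ⟨w, hw, hw'⟩ := hA
  refine ⟨fun i => v i • ofDualSection A (hw i).dualSection,
    fun i => (hw i).ofDualSection.unit_smul (hv i), fun i j => ?_⟩
  rw [resM_smul, resM_smul, (hw i).ofDualSection_transition (hw j) _ (hw' i j), smul_smul,
    smul_smul, ← h i j]
  congr 1
  ring

lemma HasCocycle.tensorPow {A : X.Modules} {f : ∀ i j, Γ(X, W i ⊓ W j)} (hA : HasCocycle A W f)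
    (n : ℕ) : HasCocycle (tensorPow A n) W fun i j => f i j ^ n := by
  induction n with
  | zero =>
    simp only [pow_zero]
    exact hasCocycle_structureSheaf
  | succ n ih =>
    simp only [pow_succ']
    exact hA.tensor ih

lemma HasCocycle.tensorZPow {A : X.Modules} {f g : ∀ i j, Γ(X, W i ⊓ W j)}
    (hA : HasCocycle A W f) (hA' : HasCocycle (DoubleCover.dual A) W g) (n : ℤ) :
    HasCocycle (tensorZPow A n) W
      fun i j => (if 0 ≤ n then f i j else g i j) ^ n.natAbs := by
  cases n with
  | ofNat n =>
    simp only [Int.ofNat_eq_natCast, Int.natCast_nonneg, if_true, Int.natAbs_natCast]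
    exact hA.tensorPow n
  | negSucc n =>
    simp only [Int.negSucc_not_nonneg, if_false, Int.natAbs_negSucc]
    exact hA'.tensorPow (n + 1)

lemma HasCocycle.multiPow {m : ℕ} {L : Fin m → X.Modules} {n : Fin m → ℤ}
    {f : Fin m → ∀ i j, Γ(X, W i ⊓ W j)}
    (h : ∀ k, HasCocycle (DoubleCover.tensorZPow (L k) (n k)) W (f k)) :
    HasCocycle (multiPow L n) W fun i j => (List.ofFn fun k => f k i j).prod := by
  unfold DoubleCover.multiPow
  induction m with
  | zero => simpa using hasCocycle_structureSheaf
  | succ m ih =>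
    simp only [List.ofFn_succ, List.foldr_cons, List.prod_cons]
    exact (h 0).tensor (ih fun k => h k.succ)

end Cocycles

/-! ### Sections of line bundles over affine open sets. -/

section Extension

variable {X : Scheme.{0}}

/-- With a generator this is the statement about functions on an affine scheme. Taking `D` up to an
equation allows `U ⊓ X.basicOpen g` later on. -/
lemma exists_pow_smul_eq_res {A : X.Modules} {U D : X.Opens} (hU : IsAffineOpen U) {w : Γ(A, U)}
    (hw : IsGenerator A w) (f : Γ(X, U)) (hD : D = X.basicOpen f) (hDU : D ≤ U) (s : Γ(A, D)) :
    ∃ (n : ℕ) (t : Γ(A, U)), resM A hDU t = resO hDU f ^ n • s := by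
  subst hD
  obtain ⟨r, rfl⟩ := (hw _ hDU).2 s
  obtain ⟨n, y, hy⟩ := exists_eq_pow_mul_of_isAffineOpen X U hU f r
  refine ⟨n, y • w, ?_⟩
  rw [resM_smul]
  simp only [smul_smul]
  congr 1

lemma exists_pow_smul_eq_zero {A : X.Modules} {U D : X.Opens} (hU : IsAffineOpen U) {w : Γ(A, U)}
    (hw : IsGenerator A w) (f : Γ(X, U)) (hD : D = X.basicOpen f) (hDU : D ≤ U) (s : Γ(A, U))
    (hs : resM A hDU s = 0) : ∃ n : ℕ, f ^ n • s = 0 := by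
  subst hD
  obtain ⟨r, rfl⟩ := (hw _ le_rfl).2 s
  simp only [resM_smul, resM_resM] at hs
  have hr : resO hDU r = 0 := (hw _ hDU).1 (by simp only [hs, zero_smul])
  obtain ⟨n, hn⟩ := exists_pow_mul_eq_zero_of_res_basicOpen_eq_zero_of_isCompact X
    hU.isCompact r f hr
  exact ⟨n, by simp only [smul_smul, hn, zero_smul]⟩

lemma basicOpen_resO {U Z : X.Opens} (h : U ≤ Z) (g : Γ(X, Z)) :
    U ⊓ X.basicOpen g = X.basicOpen (resO h g) :=
  (X.basicOpen_res g (homOfLE h).op).symm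

lemma exists_finite_basicOpen_generators {A : X.Modules} {Z : X.Opens} (hZ : IsAffineOpen Z)
    (hA : ∀ x ∈ Z, ∃ (V : X.Opens) (w : Γ(A, V)), x ∈ V ∧ IsGenerator A w) :
    ∃ (ι : Type) (_ : Finite ι) (h : ι → Γ(X, Z)) (w : ∀ a, Γ(A, X.basicOpen (h a))),
      (∀ a, IsGenerator A (w a)) ∧ Z ≤ ⨆ a, X.basicOpen (h a) := by
  have H : ∀ x : Z, ∃ (h : Γ(X, Z)) (w : Γ(A, X.basicOpen h)),
      x.1 ∈ X.basicOpen h ∧ IsGenerator A w := by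
    intro x
    obtain ⟨V, w, hxV, hw⟩ := hA x x.2
    obtain ⟨h, hV, hx⟩ := hZ.exists_basicOpen_le ⟨x.1, hxV⟩ x.2
    exact ⟨h, resM A hV w, hx, hw.restrict hV⟩
  choose h w hx hw using H
  obtain ⟨t, ht⟩ := hZ.isCompact.elim_finite_subcover (fun x : Z => (X.basicOpen (h x) : Set X))
    (fun x => (X.basicOpen (h x)).isOpen) fun x hxZ => Set.mem_iUnion.2 ⟨⟨x, hxZ⟩, hx ⟨x, hxZ⟩⟩
  refine ⟨t, inferInstance, fun a => h a, fun a => w a, fun a => hw a, fun x hxZ => ?_⟩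
  have := ht hxZ
  simp only [Set.mem_iUnion] at this
  obtain ⟨a, hat, ha⟩ := this
  exact TopologicalSpace.Opens.mem_iSup.2 ⟨⟨a, hat⟩, ha⟩

/-- Sections over a basic open subset of an affine open set extend after multiplication by a
power of the function. -/
lemma exists_pow_smul_extends {A : X.Modules} {Z : X.Opens} (hZ : IsAffineOpen Z)
    (hA : ∀ x ∈ Z, ∃ (V : X.Opens) (w : Γ(A, V)), x ∈ V ∧ IsGenerator A w)
    (g : Γ(X, Z)) (s : Γ(A, X.basicOpen g)) :
    ∃ (n : ℕ) (t : Γ(A, Z)),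
      resM A (X.basicOpen_le g) t = resO (X.basicOpen_le g) g ^ n • s := by
  obtain ⟨ι, _, h, w, hw, hcov⟩ := exists_finite_basicOpen_generators hZ hA
  have := Fintype.ofFinite ι
  let U : ι → X.Opens := fun a => X.basicOpen (h a)
  have hUZ : ∀ a, U a ≤ Z := fun a => X.basicOpen_le _
  have hUUZ : ∀ a b, U a ⊓ U b ≤ Z := fun a b => inf_le_left.trans (hUZ a)
  have hUU : ∀ a b, IsAffineOpen (U a ⊓ U b) := fun a b => by
    have := hZ.basicOpen (h a * h b)
    rwa [X.basicOpen_mul] at this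
  -- On each piece where `A` is trivial, `s` extends after multiplication by a power of `g`;
  -- finiteness of the cover then gives the common exponent `N`.
  choose n t ht using fun a => exists_pow_smul_eq_res (hZ.basicOpen (h a)) (hw a)
    (resO (hUZ a) g) (basicOpen_resO (hUZ a) g) inf_le_left (resM A inf_le_right s)
  simp only [resO_resO] at ht
  let N := ∑ a, n a
  have hN : ∀ a, N - n a + n a = N := fun a =>
    Nat.sub_add_cancel (Finset.single_le_sum (f := n) (fun _ _ => Nat.zero_le _)
      (Finset.mem_univ a))
  let t' : ∀ a, Γ(A, U a) := fun a => resO (hUZ a) g ^ (N - n a) • t a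
  have ht' : ∀ a, resM A (inf_le_left : U a ⊓ X.basicOpen g ≤ U a) (t' a) =
      resO (inf_le_left.trans (hUZ a) : U a ⊓ X.basicOpen g ≤ Z) g ^ N •
        resM A (inf_le_right : U a ⊓ X.basicOpen g ≤ X.basicOpen g) s := by
    intro a
    simp only [t', resM_smul, ht, map_pow, resO_resO, smul_smul, ← pow_add, hN]
  -- The extensions agree where `g` is invertible, so on each overlap their difference is killed by
  -- a power of `g`. Multiplying by the common power `g ^ K` makes them glue.
  choose k hk using fun ab : ι × ι => exists_pow_smul_eq_zero (hUU ab.1 ab.2)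
    ((hw ab.1).restrict inf_le_left) (resO (hUUZ ab.1 ab.2) g) (basicOpen_resO (hUUZ _ _) g)
    inf_le_left (resM A inf_le_left (t' ab.1) - resM A inf_le_right (t' ab.2)) (by
      have h1 := congrArg (resM A (le_inf (inf_le_left.trans inf_le_left) inf_le_right :
        (U ab.1 ⊓ U ab.2) ⊓ X.basicOpen g ≤ U ab.1 ⊓ X.basicOpen g)) (ht' ab.1)
      have h2 := congrArg (resM A (le_inf (inf_le_left.trans inf_le_right) inf_le_right :
        (U ab.1 ⊓ U ab.2) ⊓ X.basicOpen g ≤ U ab.2 ⊓ X.basicOpen g)) (ht' ab.2)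
      simp only [resM_smul, resM_resM, map_pow, resO_resO] at h1 h2
      rw [map_sub, resM_resM, resM_resM, h1, h2, sub_self])
  let K := ∑ ab, k ab
  have hK : ∀ ab, K - k ab + k ab = K := fun ab =>
    Nat.sub_add_cancel (Finset.single_le_sum (f := k) (fun _ _ => Nat.zero_le _)
      (Finset.mem_univ ab))
  obtain ⟨T, hT⟩ := exists_glue A U Z hUZ hcov (fun a => resO (hUZ a) g ^ K • t' a) fun a b => by
    have := hk (a, b)
    rw [smul_sub, sub_eq_zero] at this
    have := congrArg (resO (hUUZ a b) g ^ (K - k (a, b)) • ·) this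
    simp only [smul_smul, ← pow_add, hK] at this
    simpa only [resM_smul, map_pow, resO_resO] using this
  refine ⟨K + N, T, eq_of_cover A (fun a => U a ⊓ X.basicOpen g) _ (fun a => inf_le_right)
    (fun x hx => ?_) _ _ fun a => ?_⟩
  · obtain ⟨a, ha⟩ := TopologicalSpace.Opens.mem_iSup.1 (hcov (X.basicOpen_le g hx))
    exact TopologicalSpace.Opens.mem_iSup.2 ⟨a, ha, hx⟩
  · have := congrArg (resM A (inf_le_left : U a ⊓ X.basicOpen g ≤ U a)) (hT a)
    simp only [resM_smul, resM_resM, map_pow, resO_resO, ht', smul_smul, ← pow_add] at this ⊢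
    exact this

/-- A section of a line bundle over an affine open set `Z` generates it if it generates the module
of sections over `Z`. -/
lemma isGenerator_of_surjective {A : X.Modules} {Z : X.Opens} (hZ : IsAffineOpen Z)
    (hA : ∀ x ∈ Z, ∃ (V : X.Opens) (w : Γ(A, V)), x ∈ V ∧ IsGenerator A w)
    (e : Γ(A, Z)) (he : Function.Surjective fun r : Γ(X, Z) => r • e) : IsGenerator A e := by
  refine isGenerator_of_cover A e fun x hx => ?_
  obtain ⟨V, w, hxV, hw⟩ := hA x hx
  obtain ⟨g, hgV, hxg⟩ := hZ.exists_basicOpen_le ⟨x, hxV⟩ hx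
  obtain ⟨n, t, ht⟩ := exists_pow_smul_extends hZ hA g (resM A hgV w)
  obtain ⟨r, rfl⟩ := he t
  refine ⟨X.basicOpen g, X.basicOpen_le g, hxg, ?_⟩
  -- Here `g ^ n • w` extends to `r • e`, and `e = u • w` near `x`. Hence `r * u = g ^ n` is a unit
  -- on the basic open set, and so is `u`.
  obtain ⟨u, hu⟩ := (hw _ hgV).2 (resM A (X.basicOpen_le g) e)
  simp only at hu
  simp only [resM_smul] at ht
  rw [← hu, smul_smul] at ht
  rw [← hu]
  refine (hw.restrict hgV).unit_smul
    (isUnit_of_mul_isUnit_right (x := resO (X.basicOpen_le g) r) ?_)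
  rw [(hw _ hgV).1 ht]
  exact (RingedSpace.isUnit_res_basicOpen _ g).pow n

end Extension

/-! ### Rank-one trivializations as generators. -/

section LocalTriv

variable {X : Scheme.{0}}

lemma LocalTriv.isGenerator {A : X.Modules} {U : X.Opens} (φ : LocalTriv A U 1) :
    IsGenerator A ((φ.equiv U le_rfl).symm fun _ => 1) := by
  intro V h
  have h1 : φ.equiv V h (resM A h ((φ.equiv U le_rfl).symm fun _ => 1)) = fun _ => 1 := by
    funext a
    rw [φ.equiv_res U V le_rfl h, LinearEquiv.apply_symm_apply, map_one]
  have : (fun r : Γ(X, V) => φ.equiv V h (r • resM A h ((φ.equiv U le_rfl).symm fun _ => 1))) =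
      fun r _ => r := by
    funext r a
    rw [map_smul, h1, Pi.smul_apply, smul_eq_mul, mul_one]
  refine (Function.Bijective.of_comp_iff' (φ.equiv V h).bijective _).1 ?_
  change Function.Bijective (fun r : Γ(X, V) => φ.equiv V h _)
  rw [this]
  exact (Equiv.funUnique (Fin 1) Γ(X, V)).symm.bijective

lemma IsLocallyFreeOfRank.exists_generator {A : X.Modules} (hA : IsLocallyFreeOfRank A 1) (x : X) :
    ∃ (V : X.Opens) (w : Γ(A, V)), x ∈ V ∧ IsGenerator A w := by
  obtain ⟨V, hx, ⟨φ⟩⟩ := hA x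
  exact ⟨V, _, hx, φ.isGenerator⟩

lemma isLocallyFreeOfRank_one_of_isGenerator {A : X.Modules}
    (h : ∀ x : X, ∃ (V : X.Opens) (w : Γ(A, V)), x ∈ V ∧ IsGenerator A w) :
    IsLocallyFreeOfRank A 1 := by
  intro x
  obtain ⟨U, w, hx, hw⟩ := h x
  refine ⟨U, hx, ⟨⟨fun V hV => (hw.equiv hV).symm.trans (LinearEquiv.funUnique _ _ _).symm,
    fun V W hV h y a => ?_⟩⟩⟩
  obtain ⟨r, rfl⟩ := (hw V hV).2 y
  simp only [resM_smul, resM_resM, LinearEquiv.trans_apply, hw.equiv_symm_smul]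
  rfl

end LocalTriv

/-! ### Direct images and the action of `t`. -/

section Pullback

variable {X Y : Scheme.{0}} (φ : X ⟶ Y)

/-- Pullback of regular functions. -/
def pull (V : Y.Opens) : Γ(Y, V) →+* Γ(X, φ ⁻¹ᵁ V) := (φ.app V).hom

lemma preimage_le {V W : Y.Opens} (h : W ≤ V) : φ ⁻¹ᵁ W ≤ φ ⁻¹ᵁ V := fun _ hx => h hx

lemma pull_res {V W : Y.Opens} (h : W ≤ V) (r : Γ(Y, V)) :
    resO (preimage_le φ h) (pull φ V r) = pull φ W (resO h r) :=
  (congrArg (fun f => f.hom r) (φ.naturality (homOfLE h).op)).symm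

/-- A section of `A` over `φ⁻¹(V)` as a section of `φ_* A`. -/
def toPush (A : X.Modules) (V : Y.Opens) (x : Γ(A, φ ⁻¹ᵁ V)) :
    Γ((Scheme.Modules.pushforward φ).obj A, V) := x

lemma resM_toPush (A : X.Modules) {V W : Y.Opens} (h : W ≤ V) (x : Γ(A, φ ⁻¹ᵁ V)) :
    resM _ h (toPush φ A V x) = toPush φ A W (resM A (preimage_le φ h) x) := rfl

lemma resM_hom {A B : Y.Modules} (f : A ⟶ B) {V W : Y.Opens} (h : W ≤ V) (x : Γ(A, V)) :
    f.app W (resM A h x) = resM B h (f.app V x) :=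
  PresheafOfModules.naturality_apply f.val (homOfLE h).op x

end Pullback

section Presentation

variable {X Y : Scheme.{0}} {φ : X ⟶ Y} (D : Presentation φ)

lemma Presentation.mulT_res {V W : Y.Opens} (h : W ≤ V) (s : Γ(D.N, V)) :
    D.mulT (resM D.N h s) = resO (preimage_le φ h) (D.mulT s) :=
  resM_hom D.t h s

lemma Presentation.mulT_smul {V : Y.Opens} (r : Γ(Y, V)) (s : Γ(D.N, V)) :
    D.mulT (r • s) = pull φ V r * D.mulT s :=
  D.t.app_smul r s

lemma Presentation.mulT_add {V : Y.Opens} (s s' : Γ(D.N, V)) :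
    D.mulT (s + s') = D.mulT s + D.mulT s' :=
  map_add (D.t.app V).hom s s'

lemma Presentation.mulT_mul_mulT {V : Y.Opens} (s s' : Γ(D.N, V)) :
    D.mulT s * D.mulT s' = pull φ V (toFun V (D.F.app V s s')) :=
  D.mul_eq V s s'

/-- Multiplication by `t` as a morphism `(φ_* A)(-L) → φ_* A`. -/
def Presentation.actPairing (A : X.Modules) :
    Pairing ((Scheme.Modules.pushforward φ).obj A) D.N ((Scheme.Modules.pushforward φ).obj A) where
  app U := LinearMap.mk₂ Γ(Y, U) (fun x s => D.actT A x s)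
    (fun x y s => smul_add (D.mulT s) (show Γ(A, φ ⁻¹ᵁ U) from x) (show Γ(A, φ ⁻¹ᵁ U) from y))
    (fun r x s => smul_comm (D.mulT s) (pull φ U r) (show Γ(A, φ ⁻¹ᵁ U) from x))
    (fun x s s' => by
      unfold Presentation.actT
      rw [D.mulT_add, add_smul]
      rfl)
    (fun r x s => by
      unfold Presentation.actT
      rw [D.mulT_smul, mul_smul]
      rfl)
  app_res U V h a b := by
    change D.mulT (resM D.N h b) • resM A (preimage_le φ h) _ =
      resM A (preimage_le φ h) (D.mulT b • _)
    rw [resM_smul, D.mulT_res]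

end Presentation

/-! ### Functions `c_0 + c_1 t_i`, their multiplication matrices, and bases of direct images. -/

namespace TrivCover

variable {X Y : Scheme.{0}} {φ : X ⟶ Y} {D : Presentation φ} {I : Type*} (𝔘 : TrivCover D I)

lemma isGenerator_gen (i : I) : IsGenerator D.N (𝔘.gen i) := (𝔘.triv i).isGenerator

/-- The function `t_i` on the preimage of an open set `V ⊆ U_i`. -/
def tLoc (i : I) {V : Y.Opens} (h : V ≤ 𝔘.U i) : Γ(X, φ ⁻¹ᵁ V) := D.mulT (resM D.N h (𝔘.gen i))

lemma tLoc_res (i : I) {V W : Y.Opens} (h : V ≤ 𝔘.U i) (k : W ≤ V) :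
    resO (preimage_le φ k) (𝔘.tLoc i h) = 𝔘.tLoc i (k.trans h) := by
  rw [tLoc, ← D.mulT_res k, resM_resM, tLoc]

lemma tLoc_mul_self (i : I) {V : Y.Opens} (h : V ≤ 𝔘.U i) :
    𝔘.tLoc i h * 𝔘.tLoc i h = pull φ V (resO h (𝔘.Floc i)) := by
  rw [tLoc, D.mulT_mul_mulT, D.F.app_res]
  rfl

/-- The function `c_0 + c_1 t_i` on the preimage of an open set `V ⊆ U_i`. -/
def lin (i : I) {V : Y.Opens} (h : V ≤ 𝔘.U i) (c : Fin 2 → Γ(Y, V)) : Γ(X, φ ⁻¹ᵁ V) :=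
  pull φ V (c 0) + pull φ V (c 1) * 𝔘.tLoc i h

lemma lin_res (i : I) {V W : Y.Opens} (h : V ≤ 𝔘.U i) (k : W ≤ V) (c : Fin 2 → Γ(Y, V)) :
    resO (preimage_le φ k) (𝔘.lin i h c) = 𝔘.lin i (k.trans h) fun a => resO k (c a) := by
  simp only [lin, map_add, map_mul, pull_res φ k, 𝔘.tLoc_res i h k]

lemma lin_add (i : I) {V : Y.Opens} (h : V ≤ 𝔘.U i) (c d : Fin 2 → Γ(Y, V)) :
    𝔘.lin i h (c + d) = 𝔘.lin i h c + 𝔘.lin i h d := by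
  simp only [lin, Pi.add_apply, map_add]
  ring

lemma lin_smul (i : I) {V : Y.Opens} (h : V ≤ 𝔘.U i) (r : Γ(Y, V)) (c : Fin 2 → Γ(Y, V)) :
    𝔘.lin i h (r • c) = pull φ V r * 𝔘.lin i h c := by
  simp only [lin, Pi.smul_apply, smul_eq_mul, map_mul]
  ring

/-- This is the decomposition `φ_* 𝒪_X = 𝒪_Y ⊕ 𝒪_Y(-L) t`, with the second summand trivialized by
the generator over `U_i`. -/
lemma lin_bijective (i : I) {V : Y.Opens} (h : V ≤ 𝔘.U i) :
    Function.Bijective (𝔘.lin i h) := by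
  let e : (Fin 2 → Γ(Y, V)) ≃ Γ(Y, V) × Γ(D.N, V) :=
    (finTwoArrowEquiv _).trans ((Equiv.refl _).prodCongr ((𝔘.isGenerator_gen i).equiv h).toEquiv)
  have : 𝔘.lin i h = (fun z : Γ(Y, V) × Γ(D.N, V) =>
      (φ.app V).hom z.1 + toFun (φ ⁻¹ᵁ V) (D.t.app V z.2)) ∘ e := by
    funext c
    change _ = pull φ V (c 0) + D.mulT (c 1 • resM D.N h (𝔘.gen i))
    rw [D.mulT_smul]
    rfl
  rw [this]
  exact (D.bijective V).comp e.bijective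

lemma equiv_symm_const_one (j : I) {V : Y.Opens} (h : V ≤ 𝔘.U j) :
    ((𝔘.triv j).equiv V h).symm (fun _ => 1) = resM D.N h (𝔘.gen j) := by
  rw [LinearEquiv.symm_apply_eq]
  funext a
  rw [(𝔘.triv j).equiv_res (𝔘.U j) V le_rfl h, gen, LinearEquiv.apply_symm_apply, map_one]

lemma gen_transition (i j : I) : resM D.N inf_le_right (𝔘.gen j) =
    𝔘.xi i j • resM D.N inf_le_left (𝔘.gen i) := by
  apply ((𝔘.triv i).equiv (𝔘.U i ⊓ 𝔘.U j) inf_le_left).injective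
  funext a
  rw [← 𝔘.equiv_symm_const_one, ← 𝔘.equiv_symm_const_one, map_smul,
    LinearEquiv.apply_symm_apply, Subsingleton.elim a 0]
  have : (fun _ => 1 : Fin 1 → Γ(Y, 𝔘.U i ⊓ 𝔘.U j)) = Pi.single 0 1 := by
    funext b
    rw [Subsingleton.elim b 0, Pi.single_eq_same]
  simp [this, xi, LocalTriv.transition, LinearMap.toMatrix'_apply]

lemma tLoc_transition (i j : I) :
    𝔘.tLoc j (V := 𝔘.U i ⊓ 𝔘.U j) inf_le_right = pull φ _ (𝔘.xi i j) * 𝔘.tLoc i inf_le_left := by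
  rw [tLoc, gen_transition, D.mulT_smul, tLoc]

lemma lin_transition (i j : I) (c : Fin 2 → Γ(Y, 𝔘.U i ⊓ 𝔘.U j)) :
    𝔘.lin j inf_le_right c = 𝔘.lin i inf_le_left (Matrix.mulVec (𝔘.G₀ i j) c) := by
  simp [lin, tLoc_transition, G₀, Matrix.mulVec, Matrix.vecHead, Matrix.vecTail]
  ring

/-- The matrix `K` describes multiplication by `x` in the basis `1, t_i`. -/
def ActsAs (i : I) {V : Y.Opens} (h : V ≤ 𝔘.U i) (K : Matrix (Fin 2) (Fin 2) Γ(Y, V))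
    (x : Γ(X, φ ⁻¹ᵁ V)) : Prop :=
  ∀ c, 𝔘.lin i h (K.mulVec c) = x * 𝔘.lin i h c

variable {𝔘}

lemma ActsAs.mul {i : I} {V : Y.Opens} {h : V ≤ 𝔘.U i} {K K' : Matrix (Fin 2) (Fin 2) Γ(Y, V)}
    {x x' : Γ(X, φ ⁻¹ᵁ V)} (hx : 𝔘.ActsAs i h K x) (hx' : 𝔘.ActsAs i h K' x') :
    𝔘.ActsAs i h (K * K') (x * x') := fun c => by
  rw [← Matrix.mulVec_mulVec, hx, hx', mul_assoc]

lemma actsAs_one (i : I) {V : Y.Opens} (h : V ≤ 𝔘.U i) : 𝔘.ActsAs i h 1 1 := fun c => by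
  rw [Matrix.one_mulVec, one_mul]

lemma ActsAs.pow {i : I} {V : Y.Opens} {h : V ≤ 𝔘.U i} {K : Matrix (Fin 2) (Fin 2) Γ(Y, V)}
    {x : Γ(X, φ ⁻¹ᵁ V)} (hx : 𝔘.ActsAs i h K x) (n : ℕ) : 𝔘.ActsAs i h (K ^ n) (x ^ n) := by
  induction n with
  | zero => simpa only [pow_zero] using actsAs_one i h
  | succ n ih => simpa only [pow_succ] using ih.mul hx

lemma ActsAs.prod {i : I} {V : Y.Opens} {h : V ≤ 𝔘.U i} {m : ℕ}
    {K : Fin m → Matrix (Fin 2) (Fin 2) Γ(Y, V)} {x : Fin m → Γ(X, φ ⁻¹ᵁ V)}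
    (hx : ∀ k, 𝔘.ActsAs i h (K k) (x k)) :
    𝔘.ActsAs i h (List.ofFn K).prod (List.ofFn x).prod := by
  induction m with
  | zero => simpa using actsAs_one i h
  | succ m ih =>
    simp only [List.ofFn_succ, List.prod_cons]
    exact (hx 0).mul (ih fun k => hx k.succ)

/-- `M⁽⁰⁾_i` is the matrix of multiplication by `t_i`, because `t_i² = F_i`. -/
lemma actsAs_lin (i : I) {V : Y.Opens} (h : V ≤ 𝔘.U i) (c d : Γ(Y, V)) :
    𝔘.ActsAs i h (c • 1 + d • (𝔘.M₀ i).map (resO h)) (𝔘.lin i h ![c, d]) := fun v => by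
  have := 𝔘.tLoc_mul_self i h
  simp [lin, M₀, Matrix.mulVec]
  linear_combination - pull φ V d * pull φ V (v 1) * this

variable (𝔘)

/-- The trivialization of `φ_* A` with basis `w, t_i w`, for a generator `w` of `A` on the
preimage of `U_i`. -/
def basisEquiv (i : I) {A : X.Modules} {w : Γ(A, φ ⁻¹ᵁ 𝔘.U i)} (hw : IsGenerator A w)
    {V : Y.Opens} (h : V ≤ 𝔘.U i) :
    (Fin 2 → Γ(Y, V)) ≃ₗ[Γ(Y, V)] Γ((Scheme.Modules.pushforward φ).obj A, V) :=
  LinearEquiv.ofBijective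
    { toFun := fun c => toPush φ A V (𝔘.lin i h c • resM A (preimage_le φ h) w)
      map_add' := fun c d => by
        rw [lin_add, add_smul]
        rfl
      map_smul' := fun r c => by
        rw [lin_smul, mul_smul]
        rfl }
    ((hw _ (preimage_le φ h)).comp (𝔘.lin_bijective i h))

lemma basisEquiv_apply (i : I) {A : X.Modules} {w : Γ(A, φ ⁻¹ᵁ 𝔘.U i)} (hw : IsGenerator A w)
    {V : Y.Opens} (h : V ≤ 𝔘.U i) (c : Fin 2 → Γ(Y, V)) :
    𝔘.basisEquiv i hw h c = toPush φ A V (𝔘.lin i h c • resM A (preimage_le φ h) w) := rfl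

/-- The trivialization of `φ_* A` with basis `w, t_i w`, for a generator `w` of `A` on the
preimage of `U_i`. -/
def pushTriv (i : I) {A : X.Modules} {w : Γ(A, φ ⁻¹ᵁ 𝔘.U i)} (hw : IsGenerator A w) :
    LocalTriv ((Scheme.Modules.pushforward φ).obj A) (𝔘.U i) 2 where
  equiv V h := (𝔘.basisEquiv i hw h).symm
  equiv_res V W hV h x a := by
    obtain ⟨c, rfl⟩ := (𝔘.basisEquiv i hw hV).surjective x
    rw [LinearEquiv.symm_apply_apply]
    refine congrFun ((LinearEquiv.symm_apply_eq (𝔘.basisEquiv i hw (h.trans hV))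
      (y := fun a => resO h (c a))).2 ?_) a
    rw [basisEquiv_apply, basisEquiv_apply, resM_toPush, resM_smul, resM_resM, lin_res]

/-- The admissible pair is `φ_* A` itself with multiplication by `t`, trivialized by `w_i, t_i w_i`.
Passing from `j` to `i` replaces `t_j` by `ξ_ij t_i`, giving `G₀`, and `w_j` by `x_ij w_i`, giving
`K`. -/
lemma isAssociatedToRep_of_hasCocycle {A : X.Modules} {x : ∀ i j, Γ(X, φ ⁻¹ᵁ (𝔘.U i ⊓ 𝔘.U j))}
    (hA : HasCocycle A (fun i => φ ⁻¹ᵁ 𝔘.U i) x) (K : 𝔘.Mat₂)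
    (hK : ∀ i j, 𝔘.ActsAs i inf_le_left (K i j) (x i j)) :
    IsAssociatedToRep 𝔘 A (fun i j => K i j * 𝔘.G₀ i j) 𝔘.M₀ := by
  obtain ⟨w, hw, hw'⟩ := hA
  have hcov : ∀ y : Y, ∃ i, y ∈ 𝔘.U i := fun y =>
    TopologicalSpace.Opens.mem_iSup.1 (𝔘.iSup_eq_top ▸ TopologicalSpace.Opens.mem_top y)
  let P : AdmissiblePair D :=
    { bundle := (Scheme.Modules.pushforward φ).obj A
      isLocallyFree := fun y => by
        obtain ⟨i, hi⟩ := hcov y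
        exact ⟨𝔘.U i, hi, ⟨𝔘.pushTriv i (hw i)⟩⟩
      map := D.actPairing A
      map_map := fun U z s s' => by
        change D.mulT s' • (D.mulT s • (show Γ(A, φ ⁻¹ᵁ U) from z)) =
          pull φ U _ • (show Γ(A, φ ⁻¹ᵁ U) from z)
        rw [smul_smul, mul_comm, D.mulT_mul_mulT] }
  refine ⟨P, ⟨fun i => 𝔘.pushTriv i (hw i)⟩, ⟨isLocallyFreeOfRank_one_of_isGenerator fun z => ?_,
    Iso.refl _, fun _ _ _ => rfl⟩, ?_, ?_⟩
  · obtain ⟨i, hi⟩ := hcov (φ z)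
    exact ⟨φ ⁻¹ᵁ 𝔘.U i, w i, hi, hw i⟩
  · funext i j
    refine (LinearEquiv.eq_symm_apply LinearMap.toMatrix').1 (LinearMap.ext fun c => ?_)
    refine (LinearEquiv.symm_apply_eq (𝔘.basisEquiv i (hw i) inf_le_left)).2 ?_
    change 𝔘.basisEquiv j (hw j) inf_le_right c = _
    have h1 := hw' i j
    rw [basisEquiv_apply, basisEquiv_apply, lin_transition]
    rw [LinearMap.toMatrix'_symm, Matrix.toLin'_apply, ← Matrix.mulVec_mulVec, hK i j]
    rw [mul_comm, mul_smul]
    exact congrArg (fun z => toPush φ A _ (𝔘.lin i inf_le_left _ • z)) h1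
  · funext i
    refine (LinearEquiv.eq_symm_apply LinearMap.toMatrix').1 (LinearMap.ext fun c => ?_)
    refine (LinearEquiv.symm_apply_eq (𝔘.basisEquiv i (hw i) le_rfl)).2 ?_
    rw [LinearMap.toMatrix'_symm, Matrix.toLin'_apply, basisEquiv_apply]
    change toPush φ A _
      (D.mulT (𝔘.gen i) • (𝔘.lin i le_rfl c • resM A (preimage_le φ le_rfl) (w i))) = _
    -- The coefficients `0, 1` represent `t_i` itself.
    have h1 := actsAs_lin (𝔘 := 𝔘) i le_rfl 0 1 c
    have h2 : (𝔘.M₀ i).map (resO le_rfl) = 𝔘.M₀ i := by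
      ext a b
      exact resO_self _
    rw [zero_smul, one_smul, zero_add, h2] at h1
    rw [h1, smul_smul]
    simp only [lin, Matrix.cons_val_zero, Matrix.cons_val_one, map_zero, map_one, zero_add,
      one_mul, tLoc, resM_self]

end TrivCover

/-! ### Matrix relations satisfied by a representation. -/

section LocalTriv

variable {Y : Scheme.{0}} {M : Y.Modules} {U V : Y.Opens} {r : ℕ}

lemma LocalTriv.equiv_eq_transition_mulVec (φ : LocalTriv M U r) (ψ : LocalTriv M V r)
    (x : Γ(M, U ⊓ V)) :
    φ.equiv (U ⊓ V) inf_le_left x =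
      (φ.transition ψ).mulVec (ψ.equiv (U ⊓ V) inf_le_right x) := by
  rw [transition, LinearMap.toMatrix'_mulVec]
  simp

lemma LocalTriv.isUnit_det_transition (φ : LocalTriv M U r) (ψ : LocalTriv M V r) :
    IsUnit (φ.transition ψ).det :=
  LinearEquiv.isUnit_det ((ψ.equiv (U ⊓ V) inf_le_right).symm.trans
    (φ.equiv (U ⊓ V) inf_le_left)) (Pi.basisFun _ _) (Pi.basisFun _ _)

end LocalTriv

namespace Representation

variable {X Y : Scheme.{0}} {φ : X ⟶ Y} {D : Presentation φ} {P : AdmissiblePair D} {I : Type*}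
  {𝔘 : TrivCover D I} (R : Representation P 𝔘)

lemma equiv_map (i : I) {V : Y.Opens} (h : V ≤ 𝔘.U i) (x : Γ(P.bundle, V)) :
    (R.triv i).equiv V h (P.map.app V x (resM D.N h (𝔘.gen i))) =
      ((R.M i).map (resO h)).mulVec ((R.triv i).equiv V h x) := by
  have hbasis : ∀ b, (R.triv i).equiv V h
      (resM _ h (((R.triv i).equiv (𝔘.U i) le_rfl).symm (Pi.single b 1))) = Pi.single b 1 := by
    intro b
    funext a
    rw [(R.triv i).equiv_res _ V le_rfl h, LinearEquiv.apply_symm_apply]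
    by_cases hab : a = b
    · subst hab
      simp
    · simp [hab]
  let f : (Fin 2 → Γ(Y, V)) →ₗ[Γ(Y, V)] (Fin 2 → Γ(Y, V)) :=
    ((R.triv i).equiv V h).toLinearMap ∘ₗ (P.map.app V).flip (resM D.N h (𝔘.gen i)) ∘ₗ
      ((R.triv i).equiv V h).symm.toLinearMap
  have hf : f = Matrix.toLin' ((R.M i).map (resO h)) := by
    refine LinearMap.pi_ext' fun b => LinearMap.ext_ring ?_
    funext a
    have h1 : f (Pi.single b 1) a = resO h (R.M i a b) := by
      rw [← hbasis b]
      simp only [f, LinearMap.comp_apply, LinearEquiv.coe_coe, LinearEquiv.symm_apply_apply,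
        LinearMap.flip_apply]
      rw [P.map.app_res, (R.triv i).equiv_res _ V le_rfl h]
      simp [M, LinearMap.toMatrix'_apply]
    simpa using h1
  have h2 := LinearMap.congr_fun hf ((R.triv i).equiv V h x)
  simpa [f] using h2

lemma equiv_eq_G_mulVec (i j : I) (x : Γ(P.bundle, 𝔘.U i ⊓ 𝔘.U j)) :
    (R.triv i).equiv _ inf_le_left x = (R.G i j).mulVec ((R.triv j).equiv _ inf_le_right x) :=
  (R.triv i).equiv_eq_transition_mulVec (R.triv j) x

lemma M_mul_self (i : I) : R.M i * R.M i = 𝔘.Floc i • 1 := by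
  have h1 : (R.M i).map (resO le_rfl) = R.M i := by
    ext a b
    exact resO_self _
  refine Matrix.ext_of_mulVec_single fun b => ?_
  obtain ⟨x, hx⟩ := ((R.triv i).equiv (𝔘.U i) le_rfl).surjective (Pi.single b 1)
  have h2 := P.map_map (𝔘.U i) x (𝔘.gen i) (𝔘.gen i)
  have h3 := fun y => R.equiv_map i le_rfl y
  simp only [resM_self, h1] at h3
  have h4 := congrArg ((R.triv i).equiv (𝔘.U i) le_rfl) h2
  rw [h3, h3, map_smul, hx, Matrix.mulVec_mulVec] at h4
  rw [h4, Matrix.smul_mulVec, Matrix.one_mulVec]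
  rfl

/-- The factor `ξ_ij` appears because `M_j` is formed with the generator over `U_j`, which is `ξ_ij`
times the one over `U_i`. -/
lemma G_mul_M (i j : I) : R.G i j * (R.M j).map (resO inf_le_right) =
    𝔘.xi i j • ((R.M i).map (resO inf_le_left) * R.G i j) := by
  refine Matrix.ext_of_mulVec_single fun b => ?_
  obtain ⟨x, hx⟩ := ((R.triv j).equiv (𝔘.U i ⊓ 𝔘.U j) inf_le_right).surjective (Pi.single b 1)
  rw [← hx, ← Matrix.mulVec_mulVec, ← R.equiv_map, ← R.equiv_eq_G_mulVec, Matrix.smul_mulVec,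
    ← Matrix.mulVec_mulVec, ← R.equiv_eq_G_mulVec, ← R.equiv_map, 𝔘.gen_transition, map_smul,
    map_smul]

end Representation

/-! ### The norm identity for `2 × 2` matrices. -/

section MatrixAlgebra

variable {S : Type*} [CommRing S]

/-- Let `v` be the first column of `G`. Applying `G` to the first basis vector and its image under
`M'` gives `v` and `ξ M v`, so `det G * M' 1 0 = ξ det (v, M v)`. Multiplying by `M 1 0` completes
the square. -/
lemma norm_mul_eq_of_mul_eq_smul {G M M' : Matrix (Fin 2) (Fin 2) S} {F ξ : S}
    (hM : M * M = F • 1) (hG : G * M' = ξ • (M * G)) :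
    ξ * ((M 1 0 * G 0 0 - M 0 0 * G 1 0) ^ 2 - G 1 0 ^ 2 * F) = M 1 0 * M' 1 0 * G.det := by
  have e1 := congrFun (congrFun hM 0) 0
  -- This entry says that `M 1 0` kills the trace of `M`; the factor `M 1 0` in the identity makes
  -- this enough.
  have e2 := congrFun (congrFun hM 1) 0
  have e3 := congrFun (congrFun hG 0) 0
  have e4 := congrFun (congrFun hG 1) 0
  simp [Matrix.mul_apply, Fin.sum_univ_two] at e1 e2 e3 e4
  rw [Matrix.det_fin_two]
  linear_combination ξ * G 1 0 ^ 2 * e1 + M 1 0 * G 1 0 * e3 - M 1 0 * G 0 0 * e4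
    - ξ * (G 0 0 * G 1 0) * e2

lemma smul_one_add_mul_smul_one_add {N : Matrix (Fin 2) (Fin 2) S} {F : S} (hN : N * N = F • 1)
    (c d c' d' : S) : (c • 1 + d • N) * (c' • 1 + d' • N) =
      (c * c' + d * d' * F) • 1 + (c * d' + d * c') • N := by
  simp only [add_mul, mul_add, smul_mul_smul_comm, mul_one, one_mul, hN, smul_smul, add_smul]
  abel

end MatrixAlgebra

/-! ### `K⁺` and `K⁻` as combinations of `E` and `M⁽⁰⁾`. -/

namespace TrivCover

variable {X Y : Scheme.{0}} {φ : X ⟶ Y} {D : Presentation φ} {I : Type*} (𝔘 : TrivCover D I)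

lemma M₀_map_mul_self (i j : I) : (𝔘.M₀ i).map (𝔘.res i j) * (𝔘.M₀ i).map (𝔘.res i j) =
    𝔘.res i j (𝔘.Floc i) • 1 := by
  ext a b
  fin_cases a <;> fin_cases b <;> simp [M₀, Matrix.mul_apply, Fin.sum_univ_two]

/-- The coefficients of `K⁺_ij` with respect to `E` and `M⁽⁰⁾_i`. -/
def plusCoeff (G : 𝔘.Mat₂) (M : 𝔘.Mat₁) (i j : I) : Fin 2 → Γ(Y, 𝔘.U i ⊓ 𝔘.U j) :=
  let a₀ := 𝔘.res i j (M i 0 0)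
  let a₁ := 𝔘.res i j (M i 1 0)
  ![Ring.inverse a₁ * (a₁ * G i j 0 0 - a₀ * G i j 1 0), Ring.inverse a₁ * G i j 1 0]

/-- The coefficients of `K⁻_ij` with respect to `E` and `M⁽⁰⁾_i`. -/
def minusCoeff (G : 𝔘.Mat₂) (M : 𝔘.Mat₁) (i j : I) : Fin 2 → Γ(Y, 𝔘.U i ⊓ 𝔘.U j) :=
  let a₀ := 𝔘.res i j (M i 0 0)
  let a₁ := 𝔘.res i j (M i 1 0)
  let e := 𝔘.xi i j * Ring.inverse (a₁ * (G i j).det)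
  ![e * (a₁ * G i j 0 0 - a₀ * G i j 1 0), - (e * G i j 1 0)]

lemma Kplus_eq (G : 𝔘.Mat₂) (M : 𝔘.Mat₁) (i j : I) : 𝔘.Kplus G M i j =
    𝔘.plusCoeff G M i j 0 • 1 + 𝔘.plusCoeff G M i j 1 • (𝔘.M₀ i).map (𝔘.res i j) := by
  simp only [Kplus, plusCoeff, smul_add, smul_smul, Matrix.cons_val_zero, Matrix.cons_val_one]

lemma Kminus_eq (G : 𝔘.Mat₂) (M : 𝔘.Mat₁) (i j : I) : 𝔘.Kminus G M i j =
    𝔘.minusCoeff G M i j 0 • 1 + 𝔘.minusCoeff G M i j 1 • (𝔘.M₀ i).map (𝔘.res i j) := by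
  simp only [Kminus, minusCoeff, smul_sub, smul_smul, Matrix.cons_val_zero, Matrix.cons_val_one,
    neg_smul]
  exact sub_eq_add_neg _ _

lemma actsAs_Kplus (G : 𝔘.Mat₂) (M : 𝔘.Mat₁) (i j : I) :
    𝔘.ActsAs i inf_le_left (𝔘.Kplus G M i j) (𝔘.lin i inf_le_left (𝔘.plusCoeff G M i j)) := by
  rw [Kplus_eq]
  exact actsAs_lin i inf_le_left _ _

lemma actsAs_Kminus (G : 𝔘.Mat₂) (M : 𝔘.Mat₁) (i j : I) :
    𝔘.ActsAs i inf_le_left (𝔘.Kminus G M i j) (𝔘.lin i inf_le_left (𝔘.minusCoeff G M i j)) := by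
  rw [Kminus_eq]
  exact actsAs_lin i inf_le_left _ _

end TrivCover

/-! ### Consequences of goodness. -/

namespace Representation

variable {X Y : Scheme.{0}} {φ : X ⟶ Y} {D : Presentation φ} {P : AdmissiblePair D} {I : Type*}
  {𝔘 : TrivCover D I} {R : Representation P 𝔘}

/-- The left side is the `E`-coefficient of `K⁺ K⁻`, a multiple of the norm of the function behind
`K⁺`. Goodness makes both uses of `Ring.inverse` genuine inverses. -/
lemma IsGood.plusCoeff_mul_minusCoeff (hR : R.IsGood) (i j : I) :
    𝔘.plusCoeff R.G R.M i j 0 * 𝔘.minusCoeff R.G R.M i j 0 +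
      𝔘.plusCoeff R.G R.M i j 1 * 𝔘.minusCoeff R.G R.M i j 1 * 𝔘.res i j (𝔘.Floc i) =
      Ring.inverse (𝔘.res i j (R.M i 1 0)) * resO inf_le_right (R.M j 1 0) := by
  have hM : (R.M i).map (𝔘.res i j) * (R.M i).map (𝔘.res i j) = 𝔘.res i j (𝔘.Floc i) • 1 := by
    have := congrArg (fun A => A.map (𝔘.res i j)) (R.M_mul_self i)
    simp only [Matrix.map_mul] at this
    rw [this]
    ext a b
    by_cases hab : a = b <;> simp [hab]
  have key := norm_mul_eq_of_mul_eq_smul hM (R.G_mul_M i j)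
  simp only [Matrix.map_apply] at key
  have h1 : IsUnit (𝔘.res i j (R.M i 1 0)) := (hR i).map _
  have h2 := Ring.mul_inverse_cancel _ h1
  have h3 := Ring.mul_inverse_cancel _
    (h1.mul ((R.triv i).isUnit_det_transition (R.triv j)))
  change 𝔘.res i j (R.M i 1 0) * (R.G i j).det *
    Ring.inverse (𝔘.res i j (R.M i 1 0) * (R.G i j).det) = 1 at h3
  simp only [TrivCover.plusCoeff, TrivCover.minusCoeff, Matrix.cons_val_zero, Matrix.cons_val_one]
  generalize Ring.inverse (𝔘.res i j (R.M i 1 0) * (R.G i j).det) = q at *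
  generalize Ring.inverse (𝔘.res i j (R.M i 1 0)) = p at *
  linear_combination p * q * key + p * resO inf_le_right (R.M j 1 0) * h3

variable (R) in
-- The two coefficient vectors are conjugate up to a scalar, so the `M⁽⁰⁾`-part of the product
-- cancels.
lemma plusCoeff_mul_minusCoeff_add (i j : I) :
    𝔘.plusCoeff R.G R.M i j 0 * 𝔘.minusCoeff R.G R.M i j 1 +
      𝔘.plusCoeff R.G R.M i j 1 * 𝔘.minusCoeff R.G R.M i j 0 = 0 := by
  simp only [TrivCover.plusCoeff, TrivCover.minusCoeff, Matrix.cons_val_zero, Matrix.cons_val_one]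
  ring

lemma IsGood.Kplus_mul_Kminus (hR : R.IsGood) (i j : I) :
    𝔘.Kplus R.G R.M i j * 𝔘.Kminus R.G R.M i j =
      (Ring.inverse (𝔘.res i j (R.M i 1 0)) * resO inf_le_right (R.M j 1 0)) • 1 := by
  rw [𝔘.Kplus_eq, 𝔘.Kminus_eq, smul_one_add_mul_smul_one_add (𝔘.M₀_map_mul_self i j),
    hR.plusCoeff_mul_minusCoeff, plusCoeff_mul_minusCoeff_add, zero_smul, add_zero]

/-- The product `K⁺ K⁻` is a unit scalar matrix, so both determinants divide a unit. -/
lemma IsGood.isUnit_Kplus_and_Kminus (hR : R.IsGood) (i j : I) :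
    IsUnit (𝔘.Kplus R.G R.M i j) ∧ IsUnit (𝔘.Kminus R.G R.M i j) := by
  have h1 : IsUnit (𝔘.res i j (R.M i 1 0)) := (hR i).map _
  have h2 : IsUnit (resO (inf_le_right : 𝔘.U i ⊓ 𝔘.U j ≤ 𝔘.U j) (R.M j 1 0)) := (hR j).map _
  have h3 := congrArg Matrix.det (hR.Kplus_mul_Kminus i j)
  rw [Matrix.det_mul, Matrix.det_smul, Matrix.det_one, mul_one] at h3
  have h4 := ((h1.ringInverse).mul h2).pow (Fintype.card (Fin 2))
  rw [← h3] at h4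
  rw [Matrix.isUnit_iff_isUnit_det, Matrix.isUnit_iff_isUnit_det]
  exact ⟨isUnit_of_mul_isUnit_left h4, isUnit_of_mul_isUnit_right h4⟩

/-- This is the relation required by `HasCocycle.dual`, with `v_i` the pullback of `a_i1`. -/
lemma IsGood.lin_plusCoeff_mul_lin_minusCoeff (hR : R.IsGood) (i j : I) :
    resO (preimage_le φ inf_le_left) (pull φ _ (R.M i 1 0)) *
        (𝔘.lin i inf_le_left (𝔘.plusCoeff R.G R.M i j) *
          𝔘.lin i inf_le_left (𝔘.minusCoeff R.G R.M i j)) =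
      resO (preimage_le φ inf_le_right) (pull φ _ (R.M j 1 0)) := by
  have h1 := congrArg (pull φ _) (hR.plusCoeff_mul_minusCoeff i j)
  have h2 := congrArg (pull φ _) (plusCoeff_mul_minusCoeff_add R i j)
  have h3 := 𝔘.tLoc_mul_self i (inf_le_left : 𝔘.U i ⊓ 𝔘.U j ≤ _)
  have h4 := congrArg (pull φ _) (Ring.mul_inverse_cancel (𝔘.res i j (R.M i 1 0)) ((hR i).map _))
  rw [pull_res φ inf_le_left, pull_res φ inf_le_right]
  simp only [map_add, map_mul, map_zero, map_one] at h1 h2 h4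
  change _ + _ * pull φ _ (resO inf_le_left _) = _ at h1
  change pull φ _ (resO inf_le_left _) * _ = _ at h4
  simp only [TrivCover.lin]
  linear_combination pull φ _ (resO inf_le_left (R.M i 1 0)) *
    (h1 + 𝔘.tLoc i inf_le_left * h2 + pull φ _ (𝔘.plusCoeff R.G R.M i j 1) *
      pull φ _ (𝔘.minusCoeff R.G R.M i j 1) * h3) + pull φ _ (resO inf_le_right (R.M j 1 0)) * h4

variable (R) in
/-- The first basis vector of the bundle over `U_i`. -/
def firstVec (i : I) : Γ(P.bundle, 𝔘.U i) :=
  ((R.triv i).equiv (𝔘.U i) le_rfl).symm (Pi.single 0 1)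

variable (R) in
lemma equiv_firstVec (i : I) {V : Y.Opens} (h : V ≤ 𝔘.U i) :
    (R.triv i).equiv V h (resM _ h (R.firstVec i)) = Pi.single 0 1 := by
  funext a
  rw [(R.triv i).equiv_res _ V le_rfl h, firstVec, LinearEquiv.apply_symm_apply]
  fin_cases a <;> simp

variable (R) in
-- The first column of `G_ij` expresses the left side in the basis over `U_i`; the second basis
-- vector is then eliminated as `a_i1⁻¹ (M - a_i0)` applied to the first.
lemma firstVec_transition (hR : R.IsGood) (i j : I) :
    resM P.bundle inf_le_right (R.firstVec j) =
      𝔘.plusCoeff R.G R.M i j 0 • resM P.bundle inf_le_left (R.firstVec i) +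
        𝔘.plusCoeff R.G R.M i j 1 • P.map.app _ (resM P.bundle inf_le_left (R.firstVec i))
          (resM D.N inf_le_left (𝔘.gen i)) := by
  apply ((R.triv i).equiv (𝔘.U i ⊓ 𝔘.U j) inf_le_left).injective
  rw [map_add, map_smul, map_smul, R.equiv_map, R.equiv_firstVec, R.equiv_eq_G_mulVec,
    R.equiv_firstVec]
  have h2 := Ring.mul_inverse_cancel (𝔘.res i j (R.M i 1 0)) ((hR i).map _)
  funext a
  fin_cases a
  · simp [TrivCover.plusCoeff]
    change _ = _ + _ * 𝔘.res i j _
    linear_combination - R.G i j 0 0 * h2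
  · simp [TrivCover.plusCoeff]
    change _ = _ * 𝔘.res i j _
    linear_combination - R.G i j 1 0 * h2

variable (R) in
lemma exists_eq_smul_firstVec_add (hR : R.IsGood) (i : I) (z : Γ(P.bundle, 𝔘.U i)) :
    ∃ c d : Γ(Y, 𝔘.U i),
      z = c • R.firstVec i + d • P.map.app _ (R.firstVec i) (𝔘.gen i) := by
  have h1 := R.equiv_map i le_rfl (R.firstVec i)
  have h0 := R.equiv_firstVec i le_rfl
  rw [resM_self] at h1 h0
  obtain ⟨u, hu⟩ := hR i
  let v := (R.triv i).equiv (𝔘.U i) le_rfl z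
  refine ⟨v 0 - ↑u⁻¹ * v 1 * R.M i 0 0, ↑u⁻¹ * v 1,
    ((R.triv i).equiv (𝔘.U i) le_rfl).injective ?_⟩
  rw [map_add, map_smul, map_smul, h1, h0]
  funext a
  fin_cases a
  · simp [resO_self, v]
  · simp only [Matrix.mulVec_single_one]
    simp [resO_self, v, ← hu]
    rw [mul_right_comm, Units.inv_mul, one_mul]

end Representation

/-! ### Transition functions of a line bundle associated to a good representation. -/

section Final

variable {X Y : Scheme.{0}} {φ : X ⟶ Y} {D : Presentation φ} {P : AdmissiblePair D} {I : Type*}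
  {𝔘 : TrivCover D I} {R : Representation P 𝔘}

lemma AdmissiblePair.IsAssociated.hasCocycle [IsAffineHom φ] {L : X.Modules}
    (hL : P.IsAssociated L) (hR : R.IsGood) :
    HasCocycle L (fun i => φ ⁻¹ᵁ 𝔘.U i)
      fun i j => 𝔘.lin i inf_le_left (𝔘.plusCoeff R.G R.M i j) := by
  obtain ⟨hfree, Ψ, hΨ⟩ := hL
  have hinj : ∀ U : Y.Opens, Function.Injective (Ψ.hom.app U) := fun U x y h => by
    have h1 : ∀ z, Ψ.inv.app U (Ψ.hom.app U z) = z := fun z =>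
      congrArg (fun f => (Scheme.Modules.Hom.app f U) z) Ψ.hom_inv_id
    rw [← h1 x, h, h1]
  have hinv : ∀ (U : Y.Opens) z, Ψ.hom.app U (Ψ.inv.app U z) = z := fun U z =>
    congrArg (fun f => (Scheme.Modules.Hom.app f U) z) Ψ.inv_hom_id
  have key : ∀ (i : I) (V : Y.Opens) (h : V ≤ 𝔘.U i) (c : Fin 2 → Γ(Y, V)) (e : Γ(L, φ ⁻¹ᵁ V)),
      Ψ.hom.app V (toPush φ L V (𝔘.lin i h c • e)) = c 0 • Ψ.hom.app V (toPush φ L V e) +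
        c 1 • P.map.app V (Ψ.hom.app V (toPush φ L V e)) (resM D.N h (𝔘.gen i)) := by
    intro i V h c e
    rw [← hΨ, ← Scheme.Modules.Hom.app_smul, ← Scheme.Modules.Hom.app_smul, ← map_add]
    congr 1
    change (pull φ V (c 0) + pull φ V (c 1) * 𝔘.tLoc i h) • e =
      pull φ V (c 0) • e + pull φ V (c 1) • 𝔘.tLoc i h • e
    rw [add_smul, mul_smul]
  let e : ∀ i, Γ(L, φ ⁻¹ᵁ 𝔘.U i) := fun i => Ψ.inv.app (𝔘.U i) (R.firstVec i)
  have he : ∀ i, Ψ.hom.app (𝔘.U i) (toPush φ L _ (e i)) = R.firstVec i := fun i => hinv _ _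
  have he' : ∀ (i : I) (V : Y.Opens) (h : V ≤ 𝔘.U i),
      Ψ.hom.app V (toPush φ L V (resM L (preimage_le φ h) (e i))) =
        resM P.bundle h (R.firstVec i) := by
    intro i V h
    rw [← he i, ← resM_hom]
    rfl
  -- Since `φ` is affine, `φ⁻¹(U_i)` is affine, and it suffices that `e_i` spans the global sections
  -- there.
  refine ⟨e, fun i => isGenerator_of_surjective ((𝔘.affine i).preimage φ)
    (fun x _ => hfree.exists_generator x) _ fun z => ?_, fun i j => ?_⟩
  · obtain ⟨c, d, hcd⟩ := R.exists_eq_smul_firstVec_add hR i (Ψ.hom.app _ (toPush φ L _ z))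
    refine ⟨𝔘.lin i le_rfl ![c, d], hinj _ ?_⟩
    refine (key i _ le_rfl _ _).trans ?_
    rw [he, resM_self]
    exact hcd.symm
  -- Through `Ψ`, the expansion of the first basis vector over `U_j` becomes `e_j = x_ij e_i`.
  · apply hinj (𝔘.U i ⊓ 𝔘.U j)
    refine (he' j _ inf_le_right).trans (Eq.trans ?_ (key i _ inf_le_left _ _).symm)
    rw [R.firstVec_transition hR i j]
    have := he' i (𝔘.U i ⊓ 𝔘.U j) inf_le_left
    rw [← this]
    rfl

end Final

end DoubleCover

end

theorem mainTheorem1 {X Y : Scheme.{0}} (p : X ⟶ Spec (CommRingCat.of ℂ))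
    (q : Y ⟶ Spec (CommRingCat.of ℂ)) (φ : X ⟶ Y)
    (hφ : DoubleCover.IsNonsingularDoubleCover p q φ)
    (D : DoubleCover.Presentation φ)
    {I : Type*} (𝔘 : DoubleCover.TrivCover D I)
    {m : ℕ} (P : Fin m → DoubleCover.AdmissiblePair D)
    (R : ∀ k, DoubleCover.Representation (P k) 𝔘) (hR : ∀ k, (R k).IsGood)
    (L : Fin m → X.Modules) (hL : ∀ k, (P k).IsAssociated (L k)) :
    (∀ k i j, IsUnit (𝔘.Kplus (R k).G (R k).M i j) ∧ IsUnit (𝔘.Kminus (R k).G (R k).M i j)) ∧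
    ∀ n : Fin m → ℤ,
      DoubleCover.IsAssociatedToRep 𝔘 (DoubleCover.multiPow L n)
        (𝔘.groupLawG (fun k => (R k).G) (fun k => (R k).M) n) 𝔘.M₀ := by
  refine ⟨fun k i j => (hR k).isUnit_Kplus_and_Kminus i j, fun n => ?_⟩
  -- Finiteness provides the affineness of `φ` needed for `hasCocycle`.
  have := hφ.finite
  have hc := fun k => (hL k).hasCocycle (hR k)
  have hd := fun k => (hc k).dual _ (fun i => ((hR k) i).map (DoubleCover.pull φ _))
    fun i j => (hR k).lin_plusCoeff_mul_lin_minusCoeff i j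
  refine 𝔘.isAssociatedToRep_of_hasCocycle
    (DoubleCover.HasCocycle.multiPow fun k => (hc k).tensorZPow (hd k) (n k)) _ fun i j => ?_
  refine DoubleCover.TrivCover.ActsAs.prod fun k => DoubleCover.TrivCover.ActsAs.pow ?_ _
  unfold DoubleCover.TrivCover.K
  split_ifs with h
  · simp only [h]
    exact 𝔘.actsAs_Kplus _ _ i j
  · simp only [h]
    exact 𝔘.actsAs_Kminus _ _ i j
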